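/- \textbf{Conventions.} For a compact metrizable zero-dimensional space $Z$ and a subgroup $G\le \mathrm{Homeo}(Z)$, the \emph{full group} $F(G)$ is the set of all $g\in\mathrm{Homeo}(Z)$ for which there are a finite clopen partition $Z=\bigsqcup_{i=1}^n U_i$ and $\gamma_1,\dots,\gamma_n\in G$ with $g=\gamma_i$ on $U_i$ for each $i$; $G$ is \emph{full} if $G=F(G)$. An \emph{ample group over $Z$} is a countable, locally finite, full subgroup $G\le\mathrm{Homeo}(Z)$ such that $\{z\in Z:\gamma(z)=z\}$ is clopen for every $\gamma\in G$. It is \emph{minimal} if all its orbits are dense. $R_G$ denotes the orbit equivalence relation of $G$ on $Z$. Let $X$ be the Cantor space and $G$ an ample group over $X$. A closed set $K\subseteq X$ is \emph{$G$-thin} if $\mu(K)=0$ for every $G$-invariant Borel probability measure $\mu$ on $X$; it is \emph{$G$-étale} if for every $\gamma\in G$ and every clopen subset $A$ of $K$ the set $\gamma(A)\cap K$ is clopen in $K$; it is \emph{$G$-malleable} if it is closed, $G$-thin and $G$-étale. For a $G$-étale set $K$ and $\gamma\in G$ with $\gamma^2=1$, let $\gamma_K:K\to K$ be the homeomorphism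 given by $\gamma_K(x)=\gamma(x)$ if $\gamma(x)\in K$ and $\gamma_K(x)=x$ otherwise; $G_K$ denotes the smallest full subgroup of $\mathrm{Homeo}(K)$ containing $\gamma_K$ for all $\gamma\in G$ with $\gamma^2=1$. For a subgroup $\Theta\le\mathrm{Homeo}(K)$, $R_G(K,\Theta)$ denotes the finest equivalence relation on $X$ that is coarser than $R_G$ and relates $x$ to $\theta(x)$ for all $x\in K$ and $\theta\in\Theta$. \textbf{Lemma.} Let $Y$ be a compact zero-dimensional metric space, let $\Delta\le\Sigma$ be two ample groups over $Y$, and let $\Gamma$ be a minimal ample group over the Cantor space $X$. Then there exist a minimal ample group $\Lambda$ over $X$ with $\Lambda\le\Gamma$, a closed set $K\subseteq X$ which is both $\Lambda$-malleable and $\Gamma$-malleable, and a homeomorphism $h:Y\to K$ such that \[ h\Delta h^{-1}=\Lambda_K,\qquad h\Sigma h^{-1}=\Gamma_K,\qquad R_\Gamma=R_\Lambda(K,\Gamma_K). \] -/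

import Mathlib

namespace AmpleGroup

open MeasureTheory

/-- `F(Γ)`: the homeomorphisms that coincide with elements of `Γ` on the pieces of some finite
clopen partition of the space. -/
def fullHull {X : Type*} [TopologicalSpace X] (Γ : Subgroup (X ≃ₜ X)) : Set (X ≃ₜ X) :=
  {g | ∃ (n : ℕ) (U : Fin n → Set X) (γ : Fin n → (X ≃ₜ X)),
    (∀ i, IsClopen (U i)) ∧ Pairwise (fun i j => Disjoint (U i) (U j)) ∧
    (⋃ i, U i) = Set.univ ∧ (∀ i, γ i ∈ Γ) ∧ ∀ i, ∀ x ∈ U i, g x = γ i x}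

/-- `Γ` is a full group: `Γ = F(Γ)`. -/
def IsFull {X : Type*} [TopologicalSpace X] (Γ : Subgroup (X ≃ₜ X)) : Prop :=
  (Γ : Set (X ≃ₜ X)) = fullHull Γ

/-- Every finitely generated subgroup of `Γ` is finite. -/
def IsLocallyFinite {G : Type*} [Group G] (Γ : Subgroup G) : Prop :=
  ∀ s : Set G, s.Finite → s ⊆ Γ → (Subgroup.closure s : Set G).Finite

/-- Ample groups: countable, locally finite, full groups of homeomorphisms all of whose elements
have a clopen set of fixed points. -/
structure IsAmple {X : Type*} [TopologicalSpace X] (Γ : Subgroup (X ≃ₜ X)) : Prop where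
  countable : (Γ : Set (X ≃ₜ X)).Countable
  locallyFinite : IsLocallyFinite Γ
  full : IsFull Γ
  clopen_fixed : ∀ γ ∈ Γ, IsClopen {x : X | γ x = x}

/-- The orbit equivalence relation `R_Γ` on `X`. -/
def orbitRelation {X : Type*} [TopologicalSpace X] (Γ : Subgroup (X ≃ₜ X)) : Setoid X where
  r x y := ∃ γ ∈ Γ, γ x = y
  iseqv :=
    { refl := fun _ => ⟨1, Γ.one_mem, rfl⟩
      symm := by
        rintro x y ⟨γ, hγ, rfl⟩
        exact ⟨γ⁻¹, Γ.inv_mem hγ, γ.symm_apply_apply x⟩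
      trans := by
        rintro x y z ⟨γ, hγ, rfl⟩ ⟨δ, hδ, rfl⟩
        exact ⟨δ * γ, Γ.mul_mem hδ hγ, rfl⟩ }

/-- `Γ` acts minimally: every orbit is dense. -/
def IsMinimal {X : Type*} [TopologicalSpace X] (Γ : Subgroup (X ≃ₜ X)) : Prop :=
  ∀ x : X, Dense {y : X | ∃ γ ∈ Γ, γ x = y}

/-- `M(Γ)`: the `Γ`-invariant Borel probability measures on `X`. -/
def invariantMeasures {X : Type*} [TopologicalSpace X] [MeasurableSpace X]
    (Γ : Subgroup (X ≃ₜ X)) : Set (Measure X) :=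
  {μ | IsProbabilityMeasure μ ∧ ∀ γ ∈ Γ, μ.map γ = μ}

/-- `K` is `Γ`-thin: it is a null set for every `Γ`-invariant Borel probability measure. -/
def IsThin {X : Type*} [TopologicalSpace X] [MeasurableSpace X]
    (Γ : Subgroup (X ≃ₜ X)) (K : Set X) : Prop :=
  ∀ μ ∈ invariantMeasures Γ, μ K = 0

/-- `K` is `Γ`-étale: for all `γ ∈ Γ` and all clopen subsets `A` of the space `K`, the set
`γ A ∩ K` is clopen in `K`. -/
def IsEtale {X : Type*} [TopologicalSpace X] (Γ : Subgroup (X ≃ₜ X)) (K : Set X) : Prop :=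
  ∀ γ ∈ Γ, ∀ A : Set K, IsClopen A → IsClopen {y : K | ∃ a ∈ A, γ (a : X) = y}

/-- `Γ`-malleable sets: closed, `Γ`-thin and `Γ`-étale. -/
structure IsMalleable {X : Type*} [TopologicalSpace X] [MeasurableSpace X]
    (Γ : Subgroup (X ≃ₜ X)) (K : Set X) : Prop where
  closed : IsClosed K
  thin : IsThin Γ K
  etale : IsEtale Γ K

open scoped Classical in
/-- The map `γ_K : K → K`, equal to `γ x` if `γ x ∈ K` and to `x` otherwise. -/
noncomputable def inducedMap {X : Type*} [TopologicalSpace X] (γ : X ≃ₜ X) (K : Set X)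
    (x : K) : K :=
  if h : γ (x : X) ∈ K then ⟨γ (x : X), h⟩ else x

/-- `Γ_K`: the smallest full group of homeomorphisms of `K` that contains `γ_K` for every
involution `γ ∈ Γ`. -/
noncomputable def inducedGroup {X : Type*} [TopologicalSpace X] (Γ : Subgroup (X ≃ₜ X))
    (K : Set X) : Subgroup (K ≃ₜ K) :=
  sInf {H : Subgroup (K ≃ₜ K) | IsFull H ∧
    ∀ γ ∈ Γ, γ * γ = 1 → ∀ g : K ≃ₜ K, (∀ x, g x = inducedMap γ K x) → g ∈ H}

/-- If `K` is `Γ`-étale and `γ ∈ Γ` is an involution, then `γ_K` is a homeomorphism of `K`. -/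
theorem exists_homeomorph_inducedMap {X : Type*} [TopologicalSpace X] {Γ : Subgroup (X ≃ₜ X)}
    {K : Set X} (hK : IsEtale Γ K) {γ : X ≃ₜ X} (hγ : γ ∈ Γ) (hγ2 : γ * γ = 1) :
    ∃ g : K ≃ₜ K, ∀ x, g x = inducedMap γ K x := by
  classical
  have hinv : ∀ x : X, γ (γ x) = x := fun x => congrArg (fun f : X ≃ₜ X => f x) hγ2
  have hclopen : IsClopen {x : K | γ (x : X) ∈ K} := by
    convert! hK γ hγ Set.univ isClopen_univ using 1
    ext x
    constructor
    · intro h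
      exact ⟨⟨γ x, h⟩, trivial, hinv x⟩
    · rintro ⟨a, -, ha⟩
      show γ (x : X) ∈ K
      rw [← ha, hinv]
      exact a.2
  have hinvol : ∀ x, inducedMap γ K (inducedMap γ K x) = x := by
    intro x
    by_cases h : γ (x : X) ∈ K
    · simp [inducedMap, h, hinv]
    · simp [inducedMap, h]
  have hcont : Continuous (inducedMap γ K) := by
    rw [continuous_induced_rng]
    have : (Subtype.val ∘ inducedMap γ K) =
        fun x : K => if γ (x : X) ∈ K then γ (x : X) else (x : X) := by
      funext x
      by_cases h : γ (x : X) ∈ K <;> simp [inducedMap, h]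
    rw [this]
    refine Continuous.if ?_ (γ.continuous.comp continuous_subtype_val) continuous_subtype_val
    intro a ha
    have h0 := hclopen.frontier_eq
    rw [h0] at ha
    exact ha.elim
  exact ⟨⟨⟨inducedMap γ K, inducedMap γ K, hinvol, hinvol⟩, hcont, hcont⟩, fun _ => rfl⟩

/-- `Γ_K` is itself a full group. -/
theorem isFull_inducedGroup {X : Type*} [TopologicalSpace X] (Γ : Subgroup (X ≃ₜ X))
    (K : Set X) : IsFull (inducedGroup Γ K) := by
  apply Set.Subset.antisymm
  · intro g hg
    exact ⟨1, fun _ => Set.univ, fun _ => g, fun _ => isClopen_univ,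
      fun i j hij => (hij (Subsingleton.elim i j)).elim, Set.iUnion_const _, fun _ => hg,
      fun _ _ _ => rfl⟩
  · rintro g ⟨n, U, γ, h1, h2, h3, h4, h5⟩
    refine Subgroup.mem_sInf.2 fun H hH => ?_
    have h6 : g ∈ fullHull H :=
      ⟨n, U, γ, h1, h2, h3, fun i => Subgroup.mem_sInf.1 (h4 i) H hH, h5⟩
    rw [← hH.1] at h6
    exact h6

/-- `R_Γ(K, Δ)`: the finest equivalence relation on `X` that is coarser than `R_Γ` and relates
`x` to `δ x` for all `x ∈ K` and `δ ∈ Δ`. -/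
def extendedRelation {X : Type*} [TopologicalSpace X] (Γ : Subgroup (X ≃ₜ X)) (K : Set X)
    (Δ : Subgroup (K ≃ₜ K)) : Setoid X :=
  sInf {S : Setoid X | orbitRelation Γ ≤ S ∧ ∀ δ ∈ Δ, ∀ x : K, S (x : X) (δ x : X)}

/-- Conjugation `g ↦ h g h⁻¹` by a homeomorphism `h : Y → Z`. -/
def conjHomeo {Y Z : Type*} [TopologicalSpace Y] [TopologicalSpace Z] (h : Y ≃ₜ Z) :
    (Y ≃ₜ Y) →* (Z ≃ₜ Z) where
  toFun g := (h.symm.trans g).trans h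
  map_one' := by
    ext z
    exact h.apply_symm_apply z
  map_mul' f g := by
    ext z
    show h (f (g (h.symm z))) = h (f (h.symm (h (g (h.symm z)))))
    rw [h.symm_apply_apply]

end AmpleGroup

/-!
A copy `K` of `Y` inside `X`, together with the subgroup `Λ`, is obtained as the limit of a
sequence of finite approximations (`Stage`), in the manner of a construction of Bratteli diagrams.

The larger group `S` on `Y` is the increasing union of finite subgroups `H m`, each of which
permutes the blocks of a clopen partition `q m` so that an element mapping a block to itself is
the identity there; the partitions refine one another and separate points (`IsFiltration`). The
smaller group `Δ` is then the union of the groups `H m ⊓ Δ`.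

A stage consists of a finite subgroup `W` of `Γ` and two locally constant functions on `X` with
sets of points of `Y` as values. The labels mark some of the points by blocks of `q m`, each
labelled orbit of `W` receiving every block exactly once. The colours divide the orbits of `W`
into fine classes; since a colour is a saturation under `H m ⊓ Δ` of a block, its saturation under
`H m` is a coarser colour and defines coarse classes. Two labelled points are finely (coarsely)
related when their labels are translates under `H m ⊓ Δ` (under `H m`).

In the passage to the next stage (`Stage.exists_isStep`) minimality of `Γ` supplies, in one orbit,
one point over each `H m`-orbit of blocks of the next partition, and as many further points as
desired, all inequivalent under a prescribed finite group (`IsMinimal.exists_separated`). The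
labels are transported from the former along coarse classes (`newLab`), while the latter are given
colours so that every fine class meets a prescribed open set and contains many more points than
there are labels (`newCol`). All this takes place on a finite orbit, and is spread over a thin
tower above it (`exists_isTower`). Coarse classes in which no new label is placed are absorbed by
a single fine class.

The limit of the fine relations is the orbit relation of the group `Λ` (`limitGroup`), that of the
coarse relations is the orbit relation of `Γ`, and `K` (`copy`) is the set of the points that are
labelled at all stages. A point of `K` corresponds to the point of `Y` common to all its labels
(`exists_homeomorph`). Elements of `Γ` that move a point of `K` inside `K` act on labels, at some
stage and therefore at all later ones, as an element of `S`, and as an element of `Δ` if they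
belong to `Λ`; hence the two induced groups are those required (`map_conjHomeo_eq_inducedGroup`).
The many points without labels in the fine classes make `K` thin (`isThin_copy`). Finally, points
related by `Γ` that are in no fine class together must have labels placed in their coarse class at
all stages, so that each of them is `Λ`-related to a point of `K`; these two points of `K` are
related by the group induced by `Γ` (`orbitRelation_eq`).
-/

namespace AmpleGroup

open Set Filter Topology MeasureTheory

/-! ### Full groups -/

section Full

variable {X : Type*} [TopologicalSpace X]

/-- In a compact zero-dimensional space, membership in a full group can be tested locally. -/
theorem IsFull.mem_of_locally [CompactSpace X] [T2Space X] [TotallyDisconnectedSpace X]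
    {G : Subgroup (X ≃ₜ X)} (hG : IsFull G) {g : X ≃ₜ X}
    (h : ∀ x, ∃ γ ∈ G, ∀ᶠ x' in 𝓝 x, g x' = γ x') : g ∈ G := by
  classical
  choose γ hγ hev using h
  have hU : ∀ x, ∃ U : Set X, IsClopen U ∧ x ∈ U ∧ U ⊆ {x' | g x' = γ x x'} := by
    intro x
    obtain ⟨V, hV, hVo, hxV⟩ := eventually_nhds_iff.1 (hev x)
    obtain ⟨U, hU, hxU, hUV⟩ := compact_exists_isClopen_in_isOpen hVo hxV
    exact ⟨U, hU, hxU, fun y hy => hV y (hUV hy)⟩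
  choose U hUc hxU hUs using hU
  obtain ⟨t, ht⟩ := isCompact_univ.elim_finite_subcover U (fun x => (hUc x).isOpen)
    (fun x _ => mem_iUnion.2 ⟨x, hxU x⟩)
  -- Make the cover disjoint: the `i`-th piece is the `i`-th set minus all earlier ones.
  let e := t.equivFin.symm
  have hfull : g ∈ fullHull G := by
    refine ⟨t.card, fun i => U (e i) \ ⋃ j : {j // j < i}, U (e j), fun i => γ (e i),
      fun i => ?_, ?_, ?_, fun i => hγ _, fun i x hx => hUs _ hx.1⟩
    · exact (hUc _).diff (isClopen_iUnion_of_finite fun j => hUc _)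
    · intro i j hij
      rw [Set.disjoint_left]
      intro x hx hx'
      rcases lt_or_gt_of_ne hij with h | h
      · exact hx'.2 (mem_iUnion.2 ⟨⟨i, h⟩, hx.1⟩)
      · exact hx.2 (mem_iUnion.2 ⟨⟨j, h⟩, hx'.1⟩)
    · refine eq_univ_of_forall fun x => ?_
      have hne : (Finset.univ.filter fun i : Fin t.card => x ∈ U (e i)).Nonempty := by
        obtain ⟨y, hy, hxy⟩ := mem_iUnion₂.1 (ht (mem_univ x))
        exact ⟨t.equivFin ⟨y, hy⟩, by simpa [e] using hxy⟩
      refine mem_iUnion.2 ⟨Finset.min' _ hne, ?_, fun hx => ?_⟩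
      · exact (Finset.mem_filter.1 (Finset.min'_mem _ hne)).2
      · obtain ⟨j, hj⟩ := mem_iUnion.1 hx
        exact absurd (Finset.min'_le _ j.1 (by simpa using hj)) (not_le.2 j.2)
  rw [← SetLike.mem_coe, hG]
  exact hfull

/-- The element of a full group that exchanges a clopen set with a disjoint translate of it. -/
theorem IsFull.exists_swap [CompactSpace X] [T2Space X] [TotallyDisconnectedSpace X]
    {G : Subgroup (X ≃ₜ X)} (hG : IsFull G) {w : X ≃ₜ X} (hw : w ∈ G) {U : Set X}
    (hU : IsClopen U) (hd : Disjoint U (w '' U)) :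
    ∃ γ ∈ G, γ * γ = 1 ∧ (∀ x ∈ U, γ x = w x) ∧ (∀ x ∈ U, γ (w x) = x) ∧
      ∀ x, x ∉ U → x ∉ w '' U → γ x = x := by
  classical
  have hV : IsClopen (w '' U) := by
    rw [w.image_eq_preimage_symm]
    exact hU.preimage w.symm.continuous
  -- The involution equal to `w` on `U`, to its inverse on `w '' U`, and to the identity elsewhere.
  let φ : X → X := fun x => if x ∈ U then w x else if x ∈ w '' U then w.symm x else x
  have h1 : ∀ x ∈ U, φ x = w x := fun x hx => if_pos hx
  have h2 : ∀ x ∈ U, φ (w x) = x := by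
    intro x hx
    have h3 : w x ∈ w '' U := mem_image_of_mem _ hx
    have h4 : w x ∉ U := fun h => Set.disjoint_left.1 hd h h3
    simp only [φ, if_neg h4, if_pos h3, w.symm_apply_apply]
  have h3 : ∀ x, x ∉ U → x ∉ w '' U → φ x = x := by
    intro x hx hx'
    simp only [φ, if_neg hx, if_neg hx']
  have hφ : ∀ x, φ (φ x) = x := by
    intro x
    by_cases hx : x ∈ U
    · rw [h1 x hx, h2 x hx]
    · by_cases hx' : x ∈ w '' U
      · obtain ⟨y, hy, rfl⟩ := hx'
        rw [h2 y hy, h1 y hy]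
      · rw [h3 x hx hx', h3 x hx hx']
  have hloc : ∀ x, ∃ γ ∈ G, ∀ᶠ x' in 𝓝 x, φ x' = γ x' := by
    intro x
    by_cases hx : x ∈ U
    · exact ⟨w, hw, (hU.isOpen.mem_nhds hx |> eventually_of_mem <| h1)⟩
    · by_cases hx' : x ∈ w '' U
      · refine ⟨w⁻¹, G.inv_mem hw, eventually_of_mem (hV.isOpen.mem_nhds hx') ?_⟩
        rintro _ ⟨y, hy, rfl⟩
        rw [h2 y hy]
        exact (w.symm_apply_apply y).symm
      · refine ⟨1, G.one_mem, eventually_of_mem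
          ((hU.compl.inter hV.compl).isOpen.mem_nhds ⟨hx, hx'⟩) fun y hy => h3 y hy.1 hy.2⟩
  have hc : Continuous φ := continuous_iff_continuousAt.2 fun x => by
    obtain ⟨γ, -, h⟩ := hloc x
    exact γ.continuous.continuousAt.congr (h.mono fun _ h => h.symm)
  let g : X ≃ₜ X := ⟨⟨φ, φ, hφ, hφ⟩, hc, hc⟩
  exact ⟨g, hG.mem_of_locally (g := g) hloc, Homeomorph.ext hφ, h1, h2, h3⟩

end Full

/-! ### Saturations and invariant partitions -/

section Sat

variable {Y : Type*} [TopologicalSpace Y]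

/-- The union of the translates of `b` by elements of the group `H`. -/
def saturation (H : Subgroup (Y ≃ₜ Y)) (b : Set Y) : Set Y :=
  {y | ∃ s ∈ H, ∃ z ∈ b, s z = y}

theorem subset_saturation (H : Subgroup (Y ≃ₜ Y)) (b : Set Y) : b ⊆ saturation H b :=
  fun y hy => ⟨1, H.one_mem, y, hy, rfl⟩

theorem saturation_nonempty {H : Subgroup (Y ≃ₜ Y)} {b : Set Y} :
    (saturation H b).Nonempty ↔ b.Nonempty :=
  ⟨fun ⟨_, _, _, z, hz, _⟩ => ⟨z, hz⟩, fun h => h.mono (subset_saturation H b)⟩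

theorem saturation_saturation {D H : Subgroup (Y ≃ₜ Y)} (h : D ≤ H) (b : Set Y) :
    saturation H (saturation D b) = saturation H b := by
  ext y
  constructor
  · rintro ⟨s, hs, _, ⟨d, hd, z, hz, rfl⟩, rfl⟩
    exact ⟨s * d, H.mul_mem hs (h hd), z, hz, rfl⟩
  · rintro ⟨s, hs, z, hz, rfl⟩
    exact ⟨s, hs, z, subset_saturation D b hz, rfl⟩

theorem saturation_image {H : Subgroup (Y ≃ₜ Y)} {s : Y ≃ₜ Y} (hs : s ∈ H) (b : Set Y) :
    saturation H (s '' b) = saturation H b := by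
  ext y
  constructor
  · rintro ⟨t, ht, _, ⟨z, hz, rfl⟩, rfl⟩
    exact ⟨t * s, H.mul_mem ht hs, z, hz, rfl⟩
  · rintro ⟨t, ht, z, hz, rfl⟩
    refine ⟨t * s⁻¹, H.mul_mem ht (H.inv_mem hs), s z, ⟨z, hz, rfl⟩, ?_⟩
    show t (s.symm (s z)) = t z
    rw [s.symm_apply_apply]

theorem image_inv_image (s : Y ≃ₜ Y) (b : Set Y) : (s⁻¹ : Y ≃ₜ Y) '' (s '' b) = b := by
  rw [image_image]
  refine (image_congr fun y _ => ?_).trans (image_id b)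
  exact s.symm_apply_apply y

end Sat

section Blocks

variable {Y : Type*} [TopologicalSpace Y]

/-- `q` sends a point to its block in a clopen partition of the space which is invariant under
the group `H`, and such that a member of `H` mapping a block to itself fixes its points. -/
structure IsBlockMap (H : Subgroup (Y ≃ₜ Y)) (q : Y → Set Y) : Prop where
  locConst : IsLocallyConstant q
  mem_self : ∀ y, y ∈ q y
  eq_of_mem : ∀ y z, z ∈ q y → q z = q y
  equivariant : ∀ s ∈ H, ∀ y, q (s y) = s '' q y
  free : ∀ s ∈ H, ∀ y, q (s y) = q y → s y = y

/-- Blocks with the same `D`-saturation are translates of one another by an element of `D`. -/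
theorem IsBlockMap.exists_image_eq {H D : Subgroup (Y ≃ₜ Y)} {q : Y → Set Y}
    (hq : IsBlockMap H q) (hD : D ≤ H) {y z : Y}
    (h : saturation D (q y) = saturation D (q z)) : ∃ s ∈ D, q z = s '' q y := by
  have hz : z ∈ saturation D (q y) := by
    rw [h]
    exact subset_saturation D _ (hq.mem_self z)
  obtain ⟨s, hs, u, hu, rfl⟩ := hz
  exact ⟨s, hs, by rw [hq.equivariant s (hD hs), hq.eq_of_mem y u hu]⟩

/-- The block of `x` in the coarsest `H`-invariant partition that refines the fibres of `F`. -/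
def invariantBlock {α : Type*} (H : Subgroup (Y ≃ₜ Y)) (F : Y → α) (x : Y) : Set Y :=
  {y | ∀ s ∈ H, F (s y) = F (s x)}

theorem invariantBlock_eq_iff {α : Type*} {H : Subgroup (Y ≃ₜ Y)} {F : Y → α} {x y : Y} :
    invariantBlock H F x = invariantBlock H F y ↔ ∀ s ∈ H, F (s x) = F (s y) := by
  constructor
  · intro h
    have : x ∈ invariantBlock H F y := by
      rw [← h]
      exact fun s _ => rfl
    exact this
  · intro h
    ext z
    exact forall₂_congr fun s hs => by rw [h s hs]

theorem isBlockMap_invariantBlock {α : Type*} {H : Subgroup (Y ≃ₜ Y)}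
    (hH : (H : Set (Y ≃ₜ Y)).Finite) {F : Y → α} (hF : IsLocallyConstant F)
    (hfree : ∀ s ∈ H, ∀ y, F (s y) = F y → s y = y) :
    IsBlockMap H (invariantBlock H F) where
  locConst := by
    rw [IsLocallyConstant.iff_eventually_eq]
    intro x
    have : ∀ᶠ y in 𝓝 x, ∀ s ∈ (H : Set (Y ≃ₜ Y)), F (s y) = F (s x) := by
      rw [eventually_all_finite hH]
      intro s _
      exact s.continuous.continuousAt.eventually (hF.eventually_eq (s x))
    exact this.mono fun y hy => invariantBlock_eq_iff.2 hy
  mem_self x s _ := rfl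
  eq_of_mem x y h := invariantBlock_eq_iff.2 h
  equivariant s hs x := by
    ext y
    constructor
    · intro h
      refine ⟨s.symm y, fun t ht => ?_, s.apply_symm_apply y⟩
      have := h (t * s⁻¹) (H.mul_mem ht (H.inv_mem hs))
      have e : (t * s⁻¹) (s x) = t x := congrArg t (s.symm_apply_apply x)
      rw [e] at this
      exact this
    · rintro ⟨z, hz, rfl⟩ t ht
      exact hz (t * s) (H.mul_mem ht hs)
  free s hs y h := hfree s hs y (invariantBlock_eq_iff.1 h 1 H.one_mem)

/-- A finite set of homeomorphisms with clopen fixed point sets admits a locally constant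
function that separates every point from its distinct images. -/
theorem exists_locallyConstant_free [CompactSpace Y] [T2Space Y] [TotallyDisconnectedSpace Y]
    {H : Set (Y ≃ₜ Y)} (hH : H.Finite) (hfix : ∀ s ∈ H, IsClopen {y : Y | s y = y}) :
    ∃ F : Y → Set (Set Y), IsLocallyConstant F ∧ ∀ s ∈ H, ∀ y, F (s y) = F y → s y = y := by
  classical
  -- Small sets meet a translate of themselves only in fixed points; code `y` by the members of a
  -- finite cover by such sets that contain it.
  have hU : ∀ x : Y, ∃ U : Set Y, IsClopen U ∧ x ∈ U ∧
      ∀ y ∈ U, ∀ s ∈ H, s y ∈ U → s y = y := by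
    intro x
    have hev : ∃ V : Set Y, IsOpen V ∧ x ∈ V ∧ ∀ y ∈ V, ∀ s ∈ H, s y ∈ V → s y = y := by
      have h1 : ∀ s ∈ H, ∃ V : Set Y, IsOpen V ∧ x ∈ V ∧ ∀ y ∈ V, s y ∈ V → s y = y := by
        intro s hs
        by_cases hx : s x = x
        · exact ⟨_, (hfix s hs).isOpen, hx, fun y hy _ => hy⟩
        · obtain ⟨A, B, hA, hB, hxA, hxB, hAB⟩ := t2_separation hx
          refine ⟨B ∩ s ⁻¹' A, hB.inter (hA.preimage s.continuous), ⟨hxB, hxA⟩, ?_⟩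
          intro y hy hy'
          exact absurd hy'.1 (Set.disjoint_left.1 hAB hy.2)
      choose! V hVo hxV hV using h1
      refine ⟨⋂ s ∈ H, V s, hH.isOpen_biInter hVo, mem_iInter₂.2 hxV, ?_⟩
      intro y hy s hs hsy
      exact hV s hs y (mem_iInter₂.1 hy s hs) (mem_iInter₂.1 hsy s hs)
    obtain ⟨V, hVo, hxV, hV⟩ := hev
    obtain ⟨U, hUc, hxU, hUV⟩ := compact_exists_isClopen_in_isOpen hVo hxV
    exact ⟨U, hUc, hxU, fun y hy s hs hsy => hV y (hUV hy) s hs (hUV hsy)⟩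
  choose U hUc hxU hU using hU
  obtain ⟨t, ht⟩ := isCompact_univ.elim_finite_subcover U (fun x => (hUc x).isOpen)
    (fun x _ => mem_iUnion.2 ⟨x, hxU x⟩)
  refine ⟨fun y => {A | ∃ x ∈ t, A = U x ∧ y ∈ U x}, ?_, ?_⟩
  · rw [IsLocallyConstant.iff_eventually_eq]
    intro y
    have : ∀ᶠ z in 𝓝 y, ∀ x ∈ t, (z ∈ U x ↔ y ∈ U x) := by
      rw [eventually_all_finset]
      intro x _
      by_cases hy : y ∈ U x
      · exact eventually_of_mem ((hUc x).isOpen.mem_nhds hy) fun z hz => iff_of_true hz hy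
      · exact eventually_of_mem ((hUc x).compl.isOpen.mem_nhds hy)
          fun z hz => iff_of_false hz hy
    refine this.mono fun z hz => ?_
    ext A
    exact exists_congr fun x => and_congr_right fun hx => and_congr_right fun _ => hz x hx
  · intro s hs y h
    obtain ⟨x, hx, hyx⟩ := mem_iUnion₂.1 (ht (mem_univ y))
    obtain ⟨x', -, hxx', hy'⟩ := (Set.ext_iff.1 h (U x)).2 ⟨x, hx, rfl, hyx⟩
    exact hU x y hyx s hs (hxx' ▸ hy')

/-- Every locally constant function is refined by an invariant partition on which a given finite
subgroup of an ample group acts freely. -/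
theorem exists_isBlockMap [CompactSpace Y] [T2Space Y] [TotallyDisconnectedSpace Y]
    {α : Type*} {G H : Subgroup (Y ≃ₜ Y)} (hG : IsAmple G) (hHG : H ≤ G)
    (hH : (H : Set (Y ≃ₜ Y)).Finite) {F : Y → α} (hF : IsLocallyConstant F) :
    ∃ q : Y → Set Y, IsBlockMap H q ∧ ∀ x y, q x = q y → F x = F y := by
  obtain ⟨f, hf, hfree⟩ := exists_locallyConstant_free hH fun s hs => hG.clopen_fixed s (hHG hs)
  refine ⟨invariantBlock H fun y => (f y, F y), isBlockMap_invariantBlock hH (hf.prodMk hF)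
    fun s hs y h => hfree s hs y (congrArg Prod.fst h), fun x y h => ?_⟩
  exact congrArg Prod.snd (invariantBlock_eq_iff.1 h 1 H.one_mem)

end Blocks

/-! ### Filtrations of ample groups -/

/-- A filtration of a group `S` of homeomorphisms by subgroups `H m`, with finer and finer
clopen partitions whose blocks are permuted by `H m` without twisting. It presents `S` as the
group of a Bratteli diagram whose paths are the points of the space. -/
structure IsFiltration {Y : Type*} [TopologicalSpace Y] (S : Subgroup (Y ≃ₜ Y))
    (H : ℕ → Subgroup (Y ≃ₜ Y)) (q : ℕ → Y → Set Y) : Prop where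
  block_zero : ∀ y, q 0 y = univ
  mono : Monotone H
  le : ∀ m, H m ≤ S
  exhaust : ∀ s ∈ S, ∃ m, s ∈ H m
  isBlockMap : ∀ m, IsBlockMap (H m) (q m)
  refine_succ : ∀ m y, q (m + 1) y ⊆ q m y
  separating : ∀ U : Set Y, IsClopen U → ∃ m, ∀ y, y ∈ U → q m y ⊆ U

/-- Every ample group has a filtration: its finite subgroups generated by initial segments of an
enumeration, with invariant partitions refining the first clopen sets of an enumeration. -/
theorem IsAmple.exists_isFiltration {Y : Type*} [TopologicalSpace Y] [CompactSpace Y] [T2Space Y]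
    [TotallyDisconnectedSpace Y] [SecondCountableTopology Y] {S : Subgroup (Y ≃ₜ Y)}
    (hS : IsAmple S) : ∃ H q, IsFiltration S H q := by
  classical
  have : Countable (TopologicalSpace.Clopens Y) :=
    TopologicalSpace.Clopens.countable_iff_secondCountable.2 inferInstance
  obtain ⟨E, hE⟩ := exists_surjective_nat (TopologicalSpace.Clopens Y)
  have : Countable S := hS.countable.to_subtype
  obtain ⟨e, he⟩ := exists_surjective_nat S
  let gen : ℕ → Set (Y ≃ₜ Y) := fun m => (fun i => (e i : Y ≃ₜ Y)) '' Iio m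
  let H : ℕ → Subgroup (Y ≃ₜ Y) := fun m => Subgroup.closure (gen m)
  have hgen : ∀ m, gen m ⊆ S := by
    rintro m _ ⟨i, -, rfl⟩
    exact (e i).2
  have hfin : ∀ m, (H m : Set (Y ≃ₜ Y)).Finite := fun m =>
    hS.locallyFinite _ ((finite_Iio m).image _) (hgen m)
  have hmono : Monotone H := fun m n h =>
    Subgroup.closure_mono (image_mono (Iio_subset_Iio h))
  have hle : ∀ m, H m ≤ S := fun m => (Subgroup.closure_le S).2 (hgen m)
  have hf : ∀ m, ∃ F : Y → Set (Set Y), IsLocallyConstant F ∧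
      ∀ s ∈ (H m : Set (Y ≃ₜ Y)), ∀ y, F (s y) = F y → s y = y := fun m =>
    exists_locallyConstant_free (hfin m) fun s hs => hS.clopen_fixed s (hle m hs)
  choose f hf hfree using hf
  -- The partition of index `m` uses the data of index `k < m` only, so that the first is trivial.
  let F : ∀ m : ℕ, Y → Fin m → Set (Set Y) × Prop := fun m y k => (f (k + 1) y, y ∈ E k)
  have hF : ∀ m, IsLocallyConstant (F m) := by
    intro m
    rw [IsLocallyConstant.iff_eventually_eq]
    intro x
    have h1 : ∀ k : Fin m, ∀ᶠ y in 𝓝 x, F m y k = F m x k := by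
      intro k
      have h2 : ∀ᶠ y in 𝓝 x, (y ∈ E k) = (x ∈ E k) := by
        by_cases hx : x ∈ E k
        · exact eventually_of_mem ((E k).isClopen.isOpen.mem_nhds hx)
            fun z hz => propext (iff_of_true hz hx)
        · exact eventually_of_mem ((E k).isClopen.compl.isOpen.mem_nhds hx)
            fun z hz => propext (iff_of_false hz hx)
      filter_upwards [(hf (k + 1)).eventually_eq x, h2] with y h3 h4
      exact Prod.ext h3 h4
    exact (eventually_all.2 h1).mono fun y hy => funext hy
  refine ⟨H, fun m => invariantBlock (H m) (F m), ?_, hmono, hle, ?_, ?_, ?_, ?_⟩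
  · exact fun y => eq_univ_of_forall fun z s _ => funext fun k => k.elim0
  · intro s hs
    obtain ⟨i, hi⟩ := he ⟨s, hs⟩
    exact ⟨i + 1, Subgroup.subset_closure ⟨i, Nat.lt_succ_self i, congrArg Subtype.val hi⟩⟩
  · intro m
    refine isBlockMap_invariantBlock (hfin m) (hF m) fun s hs y h => ?_
    cases m with
    | zero =>
      have : s = 1 := by simpa [H, gen] using hs
      rw [this]
      rfl
    | succ m => exact hfree (m + 1) s hs y (congrArg Prod.fst (congrFun h (Fin.last m)))
  · intro m y z hz s hs
    funext k
    exact congrFun (hz s (hmono (Nat.le_succ m) hs)) k.castSucc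
  · intro U hU
    obtain ⟨k, hk⟩ := hE ⟨U, hU⟩
    refine ⟨k + 1, fun y hy z hz => ?_⟩
    have h1 : (z ∈ E k) = (y ∈ E k) :=
      congrArg Prod.snd (congrFun (hz 1 (H (k + 1)).one_mem) (Fin.last k))
    rw [hk] at h1
    exact h1.mpr hy

/-! ### Stages and their relations -/

section Stage

variable {X Y : Type*} [TopologicalSpace X] [TopologicalSpace Y]

/-- A finite approximation, inside `Γ`, to a copy of the space `Y` with its two groups. Here `q` is
a partition of `Y` into blocks and `D` a group permuting the blocks. The clopen set on which `lab`
is not empty is a neighbourhood of the copy of `Y`, divided by `lab` into pieces indexed by the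
blocks of `q`; the value `∅` means that the point carries no label. The colouring `col` cuts the
orbits of the finite group `W` into the classes of a finer relation; its values are the
`D`-saturations of blocks, and `∅` at the points whose class carries no label. -/
structure Stage (Γ : Subgroup (X ≃ₜ X)) (D : Subgroup (Y ≃ₜ Y)) (q : Y → Set Y) where
  W : Subgroup (X ≃ₜ X)
  finite : (W : Set (X ≃ₜ X)).Finite
  le : W ≤ Γ
  col : X → Set Y
  lab : X → Set Y
  col_locConst : IsLocallyConstant col
  lab_locConst : IsLocallyConstant lab
  lab_cases : ∀ x, (lab x).Nonempty → ∃ y, lab x = q y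
  col_cases : ∀ x, (col x).Nonempty → ∃ y, col x = saturation D (q y)
  col_of_lab : ∀ x, (lab x).Nonempty → col x = saturation D (lab x)
  inj : ∀ w ∈ W, ∀ x, (lab x).Nonempty → lab (w x) = lab x → w x = x
  surj : ∀ x, (col x).Nonempty → ∀ y, ∃ w ∈ W, lab (w x) = q y
  exists_col : ∃ x, (col x).Nonempty

namespace Stage

variable {Γ : Subgroup (X ≃ₜ X)} {D H : Subgroup (Y ≃ₜ Y)} {q : Y → Set Y} (st : Stage Γ D q)

/-- Two points of a `W`-orbit are finely related when they have the same colour. -/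
def Fine (x y : X) : Prop := (∃ w ∈ st.W, w x = y) ∧ st.col x = st.col y

/-- Two points of a `W`-orbit are coarsely related when their colours have the same
`H`-saturation. -/
def Coarse (H : Subgroup (Y ≃ₜ Y)) (x y : X) : Prop :=
  (∃ w ∈ st.W, w x = y) ∧ saturation H (st.col x) = saturation H (st.col y)

variable {st}

theorem Fine.refl (x : X) : st.Fine x x := ⟨⟨1, st.W.one_mem, rfl⟩, rfl⟩

theorem Fine.symm {x y : X} (h : st.Fine x y) : st.Fine y x := by
  obtain ⟨⟨w, hw, rfl⟩, h⟩ := h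
  exact ⟨⟨w⁻¹, st.W.inv_mem hw, w.symm_apply_apply x⟩, h.symm⟩

theorem Fine.trans {x y z : X} (h : st.Fine x y) (h' : st.Fine y z) : st.Fine x z := by
  obtain ⟨⟨w, hw, rfl⟩, h⟩ := h
  obtain ⟨⟨v, hv, rfl⟩, h'⟩ := h'
  exact ⟨⟨v * w, st.W.mul_mem hv hw, rfl⟩, h.trans h'⟩

theorem Fine.coarse {x y : X} (h : st.Fine x y) (H : Subgroup (Y ≃ₜ Y)) : st.Coarse H x y :=
  ⟨h.1, by rw [h.2]⟩

theorem Coarse.refl (x : X) : st.Coarse H x x := ⟨⟨1, st.W.one_mem, rfl⟩, rfl⟩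

theorem Coarse.symm {x y : X} (h : st.Coarse H x y) : st.Coarse H y x := by
  obtain ⟨⟨w, hw, rfl⟩, h⟩ := h
  exact ⟨⟨w⁻¹, st.W.inv_mem hw, w.symm_apply_apply x⟩, h.symm⟩

theorem Coarse.trans {x y z : X} (h : st.Coarse H x y) (h' : st.Coarse H y z) :
    st.Coarse H x z := by
  obtain ⟨⟨w, hw, rfl⟩, h⟩ := h
  obtain ⟨⟨v, hv, rfl⟩, h'⟩ := h'
  exact ⟨⟨v * w, st.W.mul_mem hv hw, rfl⟩, h.trans h'⟩

/-- Labels of coarsely related points differ by an element of `H`. -/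
theorem Coarse.exists_image (hD : D ≤ H) (hq : IsBlockMap H q) {x y : X} (h : st.Coarse H x y)
    (hx : (st.lab x).Nonempty) (hy : (st.lab y).Nonempty) :
    ∃ s ∈ H, st.lab y = s '' st.lab x := by
  have h1 := h.2
  rw [st.col_of_lab x hx, st.col_of_lab y hy, saturation_saturation hD,
    saturation_saturation hD] at h1
  obtain ⟨a, ha⟩ := st.lab_cases x hx
  obtain ⟨b, hb⟩ := st.lab_cases y hy
  rw [ha, hb] at h1 ⊢
  exact hq.exists_image_eq le_rfl h1

/-- Labels of finely related points differ by an element of `D`. -/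
theorem Fine.exists_image (hD : D ≤ H) (hq : IsBlockMap H q) {x y : X} (h : st.Fine x y)
    (hx : (st.lab x).Nonempty) (hy : (st.lab y).Nonempty) :
    ∃ s ∈ D, st.lab y = s '' st.lab x := by
  have h1 := h.2
  rw [st.col_of_lab x hx, st.col_of_lab y hy] at h1
  obtain ⟨a, ha⟩ := st.lab_cases x hx
  obtain ⟨b, hb⟩ := st.lab_cases y hy
  rw [ha, hb] at h1 ⊢
  exact hq.exists_image_eq hD h1

variable (st)

theorem col_nonempty {x : X} (hx : (st.lab x).Nonempty) : (st.col x).Nonempty := by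
  rw [st.col_of_lab x hx]
  exact saturation_nonempty.2 hx

/-- The labels on a labelled orbit are permuted transitively: every `H`-translate of the label of
`x` is the label of a point in the `W`-orbit of `x`. -/
theorem exists_lab_image (hq : IsBlockMap H q) {x : X} (hx : (st.lab x).Nonempty) {s : Y ≃ₜ Y}
    (hs : s ∈ H) : ∃ w ∈ st.W, st.lab (w x) = s '' st.lab x ∧ st.col (w x) =
      saturation D (s '' st.lab x) := by
  obtain ⟨y, hy⟩ := st.lab_cases x hx
  obtain ⟨w, hw, h⟩ := st.surj x (st.col_nonempty hx) (s y)
  have h1 : st.lab (w x) = s '' st.lab x := by rw [h, hy, hq.equivariant s hs]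
  refine ⟨w, hw, h1, ?_⟩
  rw [st.col_of_lab _ (by rw [h1]; exact hx.image s), h1]

/-- Every point coarsely related to a labelled point is finely related to a labelled point. -/
theorem exists_fine_lab (hq : IsBlockMap H q) {x y : X} (h : st.Coarse H x y)
    (hx : (st.lab x).Nonempty) : ∃ z, st.Fine y z ∧ (st.lab z).Nonempty := by
  have h1 : (st.col y).Nonempty := by
    rw [← saturation_nonempty (H := H), ← h.2, saturation_nonempty]
    exact st.col_nonempty hx
  obtain ⟨a, ha⟩ := st.col_cases y h1
  obtain ⟨w, hw, hwa⟩ := st.surj y h1 a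
  have h2 : (st.lab (w y)).Nonempty := by
    rw [hwa]
    exact ⟨a, hq.mem_self a⟩
  exact ⟨w y, ⟨⟨w, hw, rfl⟩, by rw [st.col_of_lab _ h2, hwa, ha]⟩, h2⟩

theorem exists_lab_eq (y : Y) : ∃ x, st.lab x = q y := by
  obtain ⟨x, hx⟩ := st.exists_col
  obtain ⟨w, -, h⟩ := st.surj x hx y
  exact ⟨w x, h⟩

/-- Exchanging a clopen set with a disjoint translate of the same colours moves every point inside
its fine class. -/
theorem exists_swap [CompactSpace X] [T2Space X] [TotallyDisconnectedSpace X] (hΓ : IsFull Γ)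
    {w : X ≃ₜ X} (hw : w ∈ st.W) {A : Set X} (hA : IsClopen A) (hd : Disjoint A (w '' A))
    (hcol : ∀ x ∈ A, st.col (w x) = st.col x) :
    ∃ γ ∈ Γ, (∀ x, st.Fine x (γ x)) ∧ ∀ x ∈ A, γ x = w x := by
  obtain ⟨γ, hγ, -, h1, h2, h3⟩ := hΓ.exists_swap (st.le hw) hA hd
  have h4 : ∀ x ∈ A, st.Fine x (w x) := fun x hx => ⟨⟨w, hw, rfl⟩, (hcol x hx).symm⟩
  refine ⟨γ, hγ, fun x => ?_, h1⟩
  by_cases hx : x ∈ A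
  · rw [h1 x hx]
    exact h4 x hx
  · by_cases hx' : x ∈ w '' A
    · obtain ⟨y, hy, rfl⟩ := hx'
      rw [h2 y hy]
      exact (h4 y hy).symm
    · rw [h3 x hx hx']
      exact Fine.refl x

/-- Finely related points are related by an element of `Γ` that moves every point inside its
fine class; near the first point it agrees with any prescribed element of `W` taking that point to
the other. -/
theorem exists_mem_eventuallyEq [CompactSpace X] [T2Space X] [TotallyDisconnectedSpace X]
    (hΓ : IsAmple Γ) {w : X ≃ₜ X} (hw : w ∈ st.W) {x : X} (hx : st.col (w x) = st.col x) :
    ∃ γ ∈ Γ, (∀ x, st.Fine x (γ x)) ∧ ∀ᶠ x' in 𝓝 x, γ x' = w x' := by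
  by_cases hwx : w x = x
  · refine ⟨1, Γ.one_mem, fun x => Fine.refl x, ?_⟩
    exact eventually_of_mem ((hΓ.clopen_fixed w (st.le hw)).isOpen.mem_nhds hwx)
      fun y hy => Eq.symm hy
  · obtain ⟨A, B, hA, hB, hxA, hxB, hAB⟩ := t2_separation hwx
    have ho : IsOpen {y | st.col (w y) = st.col y} := by
      have : IsLocallyConstant fun y => (st.col (w y), st.col y) :=
        (st.col_locConst.comp_continuous w.continuous).prodMk st.col_locConst
      exact this {p | p.1 = p.2}
    obtain ⟨U, hU, hxU, hUs⟩ := compact_exists_isClopen_in_isOpen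
      ((hB.inter (hA.preimage w.continuous)).inter ho) ⟨⟨hxB, hxA⟩, hx⟩
    have hd : Disjoint U (w '' U) := by
      rw [Set.disjoint_left]
      rintro _ h1 ⟨y, hy, rfl⟩
      exact Set.disjoint_left.1 hAB (hUs hy).1.2 (hUs h1).1.1
    obtain ⟨γ, h1, h2, h3⟩ := st.exists_swap hΓ.full hw hU hd fun y hy => (hUs hy).2
    exact ⟨γ, h1, h2, eventually_of_mem (hU.isOpen.mem_nhds hxU) h3⟩

end Stage

end Stage

/-! ### Points in general position and towers -/

section Tower

variable {X : Type*} [TopologicalSpace X]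

/-- A dense orbit meets finitely many open sets in points that are pairwise inequivalent under a
given finite group. -/
theorem IsMinimal.exists_separated [T1Space X] [∀ x : X, NeBot (𝓝[≠] x)] {Γ V : Subgroup (X ≃ₜ X)}
    (hΓ : IsMinimal Γ) (hV : (V : Set (X ≃ₜ X)).Finite) (x₀ : X) {J : Type*} [Finite J]
    (C : J → Set X) (hCo : ∀ j, IsOpen (C j)) (hC : ∀ j, (C j).Nonempty) :
    ∃ γ : J → (X ≃ₜ X), (∀ j, γ j ∈ Γ) ∧ (∀ j, γ j x₀ ∈ C j) ∧
      ∀ v ∈ V, ∀ i j, v (γ i x₀) = γ j x₀ → i = j := by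
  classical
  have key : ∀ s : Finset J, ∃ γ : J → (X ≃ₜ X), ∀ j ∈ s, γ j ∈ Γ ∧ γ j x₀ ∈ C j ∧
      ∀ v ∈ V, ∀ i ∈ s, v (γ i x₀) = γ j x₀ → i = j := by
    intro s
    induction s using Finset.induction_on with
    | empty => exact ⟨fun _ => 1, by simp⟩
    | insert a s ha ih =>
      obtain ⟨γ, hγ⟩ := ih
      let F : Set X := ⋃ j ∈ s, (fun v : X ≃ₜ X => v (γ j x₀)) '' (V : Set (X ≃ₜ X))
      have hF : F.Finite := s.finite_toSet.biUnion fun j _ => hV.image _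
      obtain ⟨_, hy, ⟨⟨g, hg, rfl⟩, hgF⟩⟩ :=
        ((hΓ x₀).sdiff_finite hF).inter_open_nonempty (C a) (hCo a) (hC a)
      have hF' : ∀ v ∈ V, ∀ j ∈ s, v (γ j x₀) ≠ g x₀ := by
        intro v hv j hj h
        exact hgF (mem_iUnion₂.2 ⟨j, hj, v, hv, h⟩)
      refine ⟨Function.update γ a g, fun j hj => ?_⟩
      have hne : ∀ i ∈ s, i ≠ a := fun i hi h => ha (h ▸ hi)
      rcases Finset.mem_insert.1 hj with rfl | hjs
      · simp only [Function.update_self]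
        refine ⟨hg, hy, fun v hv i hi h => ?_⟩
        rcases Finset.mem_insert.1 hi with rfl | hi
        · rfl
        · rw [Function.update_of_ne (hne i hi)] at h
          exact absurd h (hF' v hv i hi)
      · rw [Function.update_of_ne (hne j hjs)]
        refine ⟨(hγ j hjs).1, (hγ j hjs).2.1, fun v hv i hi h => ?_⟩
        rcases Finset.mem_insert.1 hi with rfl | hi
        · rw [Function.update_self] at h
          refine absurd ?_ (hF' v⁻¹ (V.inv_mem hv) j hjs)
          rw [← h]
          exact v.symm_apply_apply _
        · rw [Function.update_of_ne (hne i hi)] at h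
          exact (hγ j hjs).2.2 v hv i hi h
  cases nonempty_fintype J
  obtain ⟨γ, hγ⟩ := key Finset.univ
  exact ⟨γ, fun j => (hγ j (Finset.mem_univ j)).1, fun j => (hγ j (Finset.mem_univ j)).2.1,
    fun v hv i j h => (hγ j (Finset.mem_univ j)).2.2 v hv i (Finset.mem_univ i) h⟩

/-- Finitely many elements of a minimal group move every point into a given open set. -/
theorem IsMinimal.exists_finite_cover [CompactSpace X] {Γ : Subgroup (X ≃ₜ X)}
    (hΓ : IsMinimal Γ) {C : Set X} (hCo : IsOpen C) (hC : C.Nonempty) :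
    ∃ t : Set (X ≃ₜ X), t.Finite ∧ t ⊆ Γ ∧ ∀ x, ∃ γ ∈ t, γ x ∈ C := by
  have h1 : ∀ x, ∃ γ ∈ Γ, γ x ∈ C := by
    intro x
    obtain ⟨_, hy, γ, hγ, rfl⟩ := (hΓ x).inter_open_nonempty C hCo hC
    exact ⟨γ, hγ, hy⟩
  choose γ hγ hγC using h1
  obtain ⟨t, ht⟩ := isCompact_univ.elim_finite_subcover (fun x => γ x ⁻¹' C)
    (fun x => hCo.preimage (γ x).continuous) (fun x _ => mem_iUnion.2 ⟨x, hγC x⟩)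
  refine ⟨γ '' t, t.finite_toSet.image _, ?_, fun x => ?_⟩
  · rintro _ ⟨x, -, rfl⟩
    exact hγ x
  · obtain ⟨y, hy, hxy⟩ := mem_iUnion₂.1 (ht (mem_univ x))
    exact ⟨γ y, mem_image_of_mem _ hy, hxy⟩

/-- `Z` is a clopen `W`-invariant neighbourhood of `x₀` and `τ` an equivariant locally constant map
of `Z` to the `W`-orbit of `x₀` which is bijective on each `W`-orbit in `Z`. The values of `τ` off
`Z` are irrelevant. -/
structure IsTower (W : Subgroup (X ≃ₜ X)) (x₀ : X) (Z : Set X) (τ : X → X) : Prop where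
  isClopen : IsClopen Z
  locConst : IsLocallyConstant τ
  smul_mem : ∀ w ∈ W, ∀ x ∈ Z, w x ∈ Z
  smul : ∀ w ∈ W, ∀ x ∈ Z, τ (w x) = w (τ x)
  exists_eq : ∀ x ∈ Z, ∃ w ∈ W, τ x = w x₀
  base_mem : x₀ ∈ Z
  free : ∀ w ∈ W, ∀ x ∈ Z, τ (w x) = τ x → w x = x

/-- The tower over an orbit of a finite group can be chosen so thin that a given locally constant
function is constant on its levels. -/
theorem exists_isTower [CompactSpace X] [T2Space X] [TotallyDisconnectedSpace X] {α : Type*}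
    {G W : Subgroup (X ≃ₜ X)} (hG : IsAmple G) (hWG : W ≤ G) (hW : (W : Set (X ≃ₜ X)).Finite)
    {F : X → α} (hF : IsLocallyConstant F) (x₀ : X) :
    ∃ Z τ, IsTower W x₀ Z τ ∧ ∀ x ∈ Z, F (τ x) = F x := by
  classical
  obtain ⟨Q, hQ, hQF⟩ := exists_isBlockMap hG hWG hW hF
  -- The map `τ` is `t ∘ Q`: freeness makes a block meet the orbit of `x₀` in one point at most.
  let t : Set X → X := fun b =>
    if h : ∃ w ∈ W, b = Q (w x₀) then (Classical.choose h) x₀ else x₀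
  have ht : ∀ w ∈ W, t (Q (w x₀)) = w x₀ := by
    intro w hw
    have h : ∃ v ∈ W, Q (w x₀) = Q (v x₀) := ⟨w, hw, rfl⟩
    have h1 : t (Q (w x₀)) = (Classical.choose h) x₀ := dif_pos h
    obtain ⟨hv, h2⟩ := Classical.choose_spec h
    rw [h1]
    set v := Classical.choose h
    have h3 := hQ.free (v * w⁻¹) (W.mul_mem hv (W.inv_mem hw)) (w x₀)
    have h4 : (v * w⁻¹) (w x₀) = v x₀ := congrArg v (w.symm_apply_apply x₀)
    rw [h4] at h3
    exact h3 h2.symm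
  have hZc : IsLocallyConstant fun x => ∃ w ∈ W, Q x = Q (w x₀) :=
    hQ.locConst.comp fun b => ∃ w ∈ W, b = Q (w x₀)
  have hsm : ∀ w ∈ W, ∀ x v, v ∈ W → Q x = Q (v x₀) → Q (w x) = Q ((w * v) x₀) := by
    intro w hw x v hv h
    rw [hQ.equivariant w hw, h, ← hQ.equivariant w hw]
    rfl
  refine ⟨{x | ∃ w ∈ W, Q x = Q (w x₀)}, fun x => t (Q x), ⟨?_, hQ.locConst.comp t, ?_, ?_, ?_,
    ⟨1, W.one_mem, rfl⟩, ?_⟩, ?_⟩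
  · have h1 := hZc.isClopen_fiber True
    simpa using h1
  · rintro w hw x ⟨v, hv, h⟩
    exact ⟨w * v, W.mul_mem hw hv, hsm w hw x v hv h⟩
  · rintro w hw x ⟨v, hv, h⟩
    rw [hsm w hw x v hv h, ht _ (W.mul_mem hw hv), h, ht v hv]
    rfl
  · rintro x ⟨v, hv, h⟩
    exact ⟨v, hv, by rw [h, ht v hv]⟩
  · rintro w hw x ⟨v, hv, h⟩ h1
    rw [hsm w hw x v hv h, ht _ (W.mul_mem hw hv), h, ht v hv] at h1
    apply hQ.free w hw
    rw [hsm w hw x v hv h, h]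
    exact congrArg Q h1
  · rintro x ⟨v, hv, h⟩
    exact hQF _ _ (show Q (t (Q x)) = Q x by rw [h, ht v hv])

end Tower

/-! ### Labels and colours of the next stage on a single orbit -/

section Placement

variable {X Y : Type*} [TopologicalSpace X] [TopologicalSpace Y]
  {Γ V : Subgroup (X ≃ₜ X)} {D H D' H' : Subgroup (Y ≃ₜ Y)} {q q' : Y → Set Y}
  {st : Stage Γ D q} {J : Type*} {key : Set J} {z : J → X} {pt : J → Y}

/-- A choice of `V`-inequivalent points `z j`, each destined to receive the colour of the block
of `pt j` in the finer partition `q'`. The key indices represent the `H`-orbits of blocks of `q'`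
once each, and their points lie over the proper blocks of `q`. -/
structure IsPlacement (st : Stage Γ D q) (H : Subgroup (Y ≃ₜ Y)) (q' : Y → Set Y)
    (V : Subgroup (X ≃ₜ X)) (key : Set J) (z : J → X) (pt : J → Y) : Prop where
  lab_key : ∀ j ∈ key, st.lab (z j) = q (pt j)
  key_unique : ∀ i ∈ key, ∀ j ∈ key,
    saturation H (q' (pt i)) = saturation H (q' (pt j)) → i = j
  key_exists : ∀ y, ∃ j ∈ key, saturation H (q' (pt j)) = saturation H (q' y)
  separated : ∀ v ∈ V, ∀ i j, v (z i) = z j → i = j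

/-- The label in the finer partition `q'`: the block over the old label of `x` to which the block of
the key point coarsely related to `x` is carried by `H`. It is empty if there is no such point. -/
def newLab (st : Stage Γ D q) (H : Subgroup (Y ≃ₜ Y)) (q' : Y → Set Y) (key : Set J)
    (z : J → X) (pt : J → Y) (x : X) : Set Y :=
  {y | ∃ j ∈ key, st.Coarse H (z j) x ∧ st.lab x = q y ∧
    saturation H (q' (pt j)) = saturation H (q' y)}

open scoped Classical in
/-- The new colour. On fine classes that carry a new label it is forced; elsewhere it is constant
on `V`-orbits, prescribed at the points `z j`, and the colour of `j₀` in default. -/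
noncomputable def newCol (st : Stage Γ D q) (H D' : Subgroup (Y ≃ₜ Y)) (q' : Y → Set Y)
    (V : Subgroup (X ≃ₜ X)) (key : Set J) (z : J → X) (pt : J → Y) (j₀ : J) (x : X) : Set Y :=
  if h : ∃ y, st.Fine x y ∧ (newLab st H q' key z pt y).Nonempty then
    saturation D' (newLab st H q' key z pt h.choose)
  else if h : ∃ j, ∃ v ∈ V, v (z j) = x then saturation D' (q' (pt h.choose))
  else saturation D' (q' (pt j₀))

namespace IsPlacement

variable (hp : IsPlacement st H q' V key z pt) (hq : IsBlockMap H q) (hq' : IsBlockMap H' q')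
  (hH : H ≤ H') (hqq : ∀ y, q' y ⊆ q y) (hD : D ≤ H) (hDD : D ≤ D') (hD' : D' ≤ H')
  (hWV : st.W ≤ V)

include hq hqq in
/-- A translation between blocks of `q'` translates the blocks of `q` that contain them. -/
theorem block_eq_image {s : Y ≃ₜ Y} (hs : s ∈ H) {a b : Y} (h : q' b = s '' q' a)
    (hb : b ∈ q' b) : q b = s '' q a := by
  rw [h] at hb
  obtain ⟨u, hu, rfl⟩ := hb
  rw [hq.equivariant s hs, hq.eq_of_mem a u (hqq a hu)]

include hp hq hq' hH hqq hWV in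
/-- The new label is a single block: the key point is determined by `x`, since the points `z j` are
inequivalent, and blocks over the same block of `q` that are `H`-translates coincide by freeness. -/
theorem newLab_eq {x : X} {y : Y} (hy : y ∈ newLab st H q' key z pt x) :
    newLab st H q' key z pt x = q' y := by
  obtain ⟨j, hj, hjx, hxy, hjy⟩ := hy
  ext a
  constructor
  · rintro ⟨i, hi, hix, hxa, hia⟩
    obtain ⟨v, hv, hvi⟩ := (hix.trans hjx.symm).1
    have hij : i = j := hp.separated v (hWV hv) i j hvi
    subst hij
    obtain ⟨s, hs, h⟩ := hq'.exists_image_eq hH (hjy.symm.trans hia)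
    have h1 : q (s y) = q y := by
      rw [hq.equivariant s hs, ← block_eq_image hq hqq hs h (hq'.mem_self a), ← hxa, hxy]
    have h2 : q' a = q' y := by rw [h, ← hq'.equivariant s (hH hs), hq.free s hs y h1]
    rw [← h2]
    exact hq'.mem_self a
  · intro ha
    have h1 := hq'.eq_of_mem y a ha
    exact ⟨j, hj, hjx, by rw [hxy, hq.eq_of_mem y a (hqq y ha)], by rw [hjy, h1]⟩

include hq in
theorem newLab_subset (x : X) : newLab st H q' key z pt x ⊆ st.lab x := by
  rintro y ⟨j, hj, hjx, hxy, hjy⟩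
  rw [hxy]
  exact hq.mem_self y

include hq in
theorem lab_nonempty {x : X} (hx : (newLab st H q' key z pt x).Nonempty) :
    (st.lab x).Nonempty := hx.mono (newLab_subset hq x)

include hq hq' hH in
theorem newLab_image {x x' : X} (hxx : st.Coarse H x x') {s : Y ≃ₜ Y} (hs : s ∈ H)
    (h : st.lab x' = s '' st.lab x) :
    newLab st H q' key z pt x' = s '' newLab st H q' key z pt x := by
  have key_sub : ∀ {x x' : X}, st.Coarse H x x' → ∀ {s : Y ≃ₜ Y}, s ∈ H →
      st.lab x' = s '' st.lab x →
      s '' newLab st H q' key z pt x ⊆ newLab st H q' key z pt x' := by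
    rintro x x' hxx s hs h _ ⟨y, ⟨j, hj, hjx, hxy, hjy⟩, rfl⟩
    refine ⟨j, hj, hjx.trans hxx, ?_, ?_⟩
    · rw [h, hxy, hq.equivariant s hs]
    · rw [hjy, hq'.equivariant s (hH hs), saturation_image hs]
  refine Subset.antisymm (fun y hy => ?_) (key_sub hxx hs h)
  have h1 : st.lab x = (s⁻¹ : Y ≃ₜ Y) '' st.lab x' := by rw [h, image_inv_image]
  exact ⟨s.symm y, key_sub hxx.symm (H.inv_mem hs) h1 ⟨y, hy, rfl⟩, s.apply_symm_apply y⟩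

include hp hq in
/-- No block is placed at two different points of the space. -/
theorem newLab_injective {x x' : X} (hx : (newLab st H q' key z pt x).Nonempty)
    (h : newLab st H q' key z pt x' = newLab st H q' key z pt x) : x' = x := by
  obtain ⟨y, hy⟩ := hx
  have hy' := hy
  rw [← h] at hy'
  obtain ⟨j, hj, hjx, hxy, hjy⟩ := hy
  obtain ⟨i, hi, hix, hxy', hiy⟩ := hy'
  have hij := hp.key_unique i hi j hj (hiy.trans hjy.symm)
  subst hij
  obtain ⟨w, hw, rfl⟩ := (hjx.symm.trans hix).1
  exact st.inj w hw x (by rw [hxy]; exact ⟨y, hq.mem_self y⟩) (hxy'.trans hxy.symm)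

include hp hq hq' hH hqq hD hWV in
theorem exists_newLab_eq (y : Y) :
    ∃ j ∈ key, ∃ w ∈ st.W, newLab st H q' key z pt (w (z j)) = q' y := by
  obtain ⟨j, hj, hjy⟩ := hp.key_exists y
  obtain ⟨s, hs, h⟩ := hq'.exists_image_eq hH hjy
  have h1 := block_eq_image hq hqq hs h (hq'.mem_self y)
  have hz : (st.lab (z j)).Nonempty := by
    rw [hp.lab_key j hj]
    exact ⟨pt j, hq.mem_self _⟩
  obtain ⟨w, hw, h2, h3⟩ := st.exists_lab_image hq hz hs
  refine ⟨j, hj, w, hw, hp.newLab_eq hq hq' hH hqq hWV ⟨j, hj, ⟨⟨w, hw, rfl⟩, ?_⟩, ?_, hjy⟩⟩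
  · rw [h3, st.col_of_lab _ hz, saturation_saturation hD, saturation_saturation hD,
      saturation_image hs]
  · rw [h2, h1, hp.lab_key j hj]

include hp hq hq' hH hqq hWV in
theorem exists_newLab_of_nonempty {x : X} (hx : (newLab st H q' key z pt x).Nonempty) :
    ∃ y, newLab st H q' key z pt x = q' y :=
  ⟨hx.some, hp.newLab_eq hq hq' hH hqq hWV hx.some_mem⟩

include hq hq' hH hD hDD in
theorem saturation_newLab_of_fine {x x' : X} (h : st.Fine x x')
    (hx : (newLab st H q' key z pt x).Nonempty) (hx' : (newLab st H q' key z pt x').Nonempty) :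
    saturation D' (newLab st H q' key z pt x') = saturation D' (newLab st H q' key z pt x) := by
  obtain ⟨s, hs, h1⟩ := h.exists_image hD hq (lab_nonempty hq hx) (lab_nonempty hq hx')
  rw [newLab_image hq hq' hH (h.coarse H) (hD hs) h1, saturation_image (hDD hs)]

variable {j₀ : J}

include hq hq' hH hD hDD in
theorem newCol_of_fine {x x' : X} (h : st.Fine x x')
    (hx' : (newLab st H q' key z pt x').Nonempty) :
    newCol st H D' q' V key z pt j₀ x = saturation D' (newLab st H q' key z pt x') := by
  have h1 : ∃ y, st.Fine x y ∧ (newLab st H q' key z pt y).Nonempty := ⟨x', h, hx'⟩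
  rw [newCol, dif_pos h1]
  exact saturation_newLab_of_fine hq hq' hH hD hDD (h.symm.trans h1.choose_spec.1) hx'
    h1.choose_spec.2

include hp in
theorem newCol_of_eq {x : X} (h : ¬∃ y, st.Fine x y ∧ (newLab st H q' key z pt y).Nonempty)
    {j : J} {v : X ≃ₜ X} (hv : v ∈ V) (hj : v (z j) = x) :
    newCol st H D' q' V key z pt j₀ x = saturation D' (q' (pt j)) := by
  have h1 : ∃ j, ∃ v ∈ V, v (z j) = x := ⟨j, v, hv, hj⟩
  rw [newCol, dif_neg h, dif_pos h1]
  obtain ⟨u, hu, huj⟩ := h1.choose_spec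
  have h2 := hp.separated (u⁻¹ * v) (V.mul_mem (V.inv_mem hu) hv) j h1.choose (by
    show u.symm (v (z j)) = _
    rw [hj]
    conv_lhs => rw [← huj]
    exact u.symm_apply_apply _)
  rw [← h2]

theorem newCol_of_not {x : X} (h : ¬∃ y, st.Fine x y ∧ (newLab st H q' key z pt y).Nonempty)
    (hj : ¬∃ j, ∃ v ∈ V, v (z j) = x) :
    newCol st H D' q' V key z pt j₀ x = saturation D' (q' (pt j₀)) := by
  rw [newCol, dif_neg h, dif_neg hj]

include hp hq hq' hH hqq hWV in
theorem exists_newCol (x : X) : ∃ y, newCol st H D' q' V key z pt j₀ x = saturation D' (q' y) := by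
  by_cases h : ∃ y, st.Fine x y ∧ (newLab st H q' key z pt y).Nonempty
  · obtain ⟨y, hy⟩ := hp.exists_newLab_of_nonempty hq hq' hH hqq hWV h.choose_spec.2
    exact ⟨y, by rw [newCol, dif_pos h, hy]⟩
  · by_cases hj : ∃ j, ∃ v ∈ V, v (z j) = x
    · obtain ⟨j, v, hv, hj⟩ := hj
      exact ⟨pt j, hp.newCol_of_eq h hv hj⟩
    · exact ⟨pt j₀, newCol_of_not h hj⟩

include hp in
/-- Off the fine classes that carry a new label, the new colour is constant on `V`-orbits. -/
theorem newCol_eq_of_not {x x' : X} {v : X ≃ₜ X} (hv : v ∈ V) (hxx : v x = x')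
    (h : ¬∃ y, st.Fine x y ∧ (newLab st H q' key z pt y).Nonempty)
    (h' : ¬∃ y, st.Fine x' y ∧ (newLab st H q' key z pt y).Nonempty) :
    newCol st H D' q' V key z pt j₀ x = newCol st H D' q' V key z pt j₀ x' := by
  by_cases hj : ∃ j, ∃ u ∈ V, u (z j) = x
  · obtain ⟨j, u, hu, hj⟩ := hj
    have hj' : (v * u) (z j) = x' := by
      rw [← hxx, ← hj]
      rfl
    rw [hp.newCol_of_eq h hu hj, hp.newCol_of_eq h' (V.mul_mem hv hu) hj']
  · rw [newCol_of_not h hj, newCol_of_not h']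
    rintro ⟨j, u, hu, hj'⟩
    refine hj ⟨j, v⁻¹ * u, V.mul_mem (V.inv_mem hv) hu, ?_⟩
    show v.symm (u (z j)) = x
    rw [hj', ← hxx, v.symm_apply_apply]

include hp hq hq' hH hD hDD hWV in
/-- The new colour is constant on the old fine classes. -/
theorem newCol_fine {x x' : X} (h : st.Fine x x') :
    newCol st H D' q' V key z pt j₀ x = newCol st H D' q' V key z pt j₀ x' := by
  by_cases hx : ∃ y, st.Fine x y ∧ (newLab st H q' key z pt y).Nonempty
  · obtain ⟨y, hy, hy'⟩ := hx
    rw [newCol_of_fine hq hq' hH hD hDD hy hy',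
      newCol_of_fine hq hq' hH hD hDD (h.symm.trans hy) hy']
  · obtain ⟨w, hw, hwx⟩ := h.1
    exact hp.newCol_eq_of_not (hWV hw) hwx hx fun ⟨y, hy, hy'⟩ => hx ⟨y, h.trans hy, hy'⟩

include hp hWV in
/-- If two coarsely related points get different new colours, a new label was placed in their
coarse class. -/
theorem newCol_coarse {x x' : X} (h : st.Coarse H x x') :
    newCol st H D' q' V key z pt j₀ x = newCol st H D' q' V key z pt j₀ x' ∨
      ∃ y, st.Coarse H x y ∧ (newLab st H q' key z pt y).Nonempty := by
  by_cases hx : ∃ y, st.Coarse H x y ∧ (newLab st H q' key z pt y).Nonempty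
  · exact Or.inr hx
  · obtain ⟨w, hw, hwx⟩ := h.1
    exact Or.inl (hp.newCol_eq_of_not (hWV hw) hwx
      (fun ⟨y, hy, hy'⟩ => hx ⟨y, hy.coarse H, hy'⟩)
      fun ⟨y, hy, hy'⟩ => hx ⟨y, h.trans (hy.coarse H), hy'⟩)

include hp hq hq' hH hqq hD hDD hD' hWV in
/-- On the `V`-orbit of `z j` the new colours all have the `H'`-saturation of the block of `pt j`,
also where the colour is forced by a new label. -/
theorem saturation_newCol_of_eq {x : X} {j : J} {v : X ≃ₜ X} (hv : v ∈ V) (hj : v (z j) = x) :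
    saturation H' (newCol st H D' q' V key z pt j₀ x) = saturation H' (q' (pt j)) := by
  by_cases h : ∃ y, st.Fine x y ∧ (newLab st H q' key z pt y).Nonempty
  · obtain ⟨y, hxy, hy⟩ := h
    rw [newCol_of_fine hq hq' hH hD hDD hxy hy, saturation_saturation hD']
    obtain ⟨a, i, hi, hiy, hya, hia⟩ := hy
    rw [hp.newLab_eq hq hq' hH hqq hWV ⟨i, hi, hiy, hya, hia⟩]
    obtain ⟨w, hw, hwi⟩ := (hiy.trans (hxy.coarse H).symm).1
    have h2 := hp.separated (v⁻¹ * w) (V.mul_mem (V.inv_mem hv) (hWV hw)) i j (by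
      show v.symm (w (z i)) = _
      rw [hwi, ← hj, v.symm_apply_apply])
    rw [← h2, ← saturation_saturation hH (q' (pt i)), hia, saturation_saturation hH]
  · rw [hp.newCol_of_eq h hv hj, saturation_saturation hD']

include hp hq hq' hH hqq hD hDD hD' hWV in
/-- The `H'`-saturation of the new colour is constant on `V`-orbits. -/
theorem saturation_newCol_smul {v : X ≃ₜ X} (hv : v ∈ V) (x : X) :
    saturation H' (newCol st H D' q' V key z pt j₀ (v x)) =
      saturation H' (newCol st H D' q' V key z pt j₀ x) := by
  by_cases hj : ∃ j, ∃ u ∈ V, u (z j) = x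
  · obtain ⟨j, u, hu, hj⟩ := hj
    have hj' : (v * u) (z j) = v x := congrArg v hj
    rw [hp.saturation_newCol_of_eq hq hq' hH hqq hD hDD hD' hWV hu hj,
      hp.saturation_newCol_of_eq hq hq' hH hqq hD hDD hD' hWV (V.mul_mem hv hu) hj']
  · -- A fine class carrying a new label contains a translate of some `z j`.
    have h1 : ∀ x', (∃ u ∈ V, u x' = x) →
        ¬∃ y, st.Fine x' y ∧ (newLab st H q' key z pt y).Nonempty := by
      rintro x' ⟨u, hu, hux⟩ ⟨y, hy, a, i, hi, hiy, -, -⟩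
      obtain ⟨w, hw, hwi⟩ := (hiy.trans (hy.coarse H).symm).1
      exact hj ⟨i, u * w, V.mul_mem hu (hWV hw), by rw [← hux, ← hwi]; rfl⟩
    rw [hp.newCol_eq_of_not hv rfl (h1 x ⟨1, V.one_mem, rfl⟩)
      (h1 (v x) ⟨v⁻¹, V.inv_mem hv, v.symm_apply_apply x⟩)]

include hp hWV in
theorem not_coarse_of_notMem {j : J} (hj : j ∉ key) {x : X} (h : st.Coarse H (z j) x) :
    ¬(newLab st H q' key z pt x).Nonempty := by
  rintro ⟨a, i, hi, hix, -, -⟩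
  obtain ⟨w, hw, hwi⟩ := (hix.trans h.symm).1
  exact hj (hp.separated w (hWV hw) i j hwi ▸ hi)

include hp hWV in
theorem newCol_of_notMem {j : J} (hj : j ∉ key) :
    newCol st H D' q' V key z pt j₀ (z j) = saturation D' (q' (pt j)) :=
  hp.newCol_of_eq (fun ⟨_, hy, hy'⟩ => hp.not_coarse_of_notMem hWV hj (hy.coarse H) hy') V.one_mem
    rfl

end IsPlacement

end Placement

/-! ### The next stage -/

section Step

universe v

variable {X : Type*} {Y : Type v} [TopologicalSpace X] [TopologicalSpace Y]
  {Γ : Subgroup (X ≃ₜ X)} {D H D' H' : Subgroup (Y ≃ₜ Y)} {q q' : Y → Set Y}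

/-- The stage `st'` refines the stage `st` and takes care of the element `σ`, of the clopen set `C`
and of the bound `1 / N` for the measure of the labelled set. The field `absorb` says that the fine
relation of `st'` contains the coarse relation of `st` away from the coarse classes of the points
labelled by `st'`. The field `thin` gives so many disjoint translates of the set of points with a
given label that an invariant probability measure gives all labelled points together at most
`1 / N`. -/
structure IsStep (st : Stage Γ D q) (st' : Stage Γ D' q') (H H' : Subgroup (Y ≃ₜ Y))
    (σ : X ≃ₜ X) (C : Set X) (N : ℕ) : Prop where
  le : st.W ≤ st'.W
  coarse_smul : ∀ w ∈ st.W, ∀ x, st'.Coarse H' x (w x)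
  coarse_apply : ∀ x, st'.Coarse H' x (σ x)
  fine : ∀ x y, st.Fine x y → st'.Fine x y
  lab_subset : ∀ x, st'.lab x ⊆ st.lab x
  lab_image : ∀ x y, st.Coarse H x y → ∀ s ∈ H, st.lab y = s '' st.lab x →
    st'.lab y = s '' st'.lab x
  absorb : ∀ x y, st.Coarse H x y → st'.Fine x y ∨ ∃ z, st.Coarse H x z ∧ (st'.lab z).Nonempty
  separates : ∀ x y, (st'.lab x).Nonempty → st'.lab x = st'.lab y → x ∈ C → y ∈ C
  dense : ∀ x, ∃ y ∈ C, st'.Fine x y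
  thin : ∀ y, ∃ γ : Fin (N * (range q').ncard) → (X ≃ₜ X),
    (∀ j, γ j ∈ Γ ∧ ∀ x, st'.Fine x (γ j x)) ∧
    Pairwise fun i j => Disjoint (γ i '' {x | st'.lab x = q' y}) (γ j '' {x | st'.lab x = q' y})

variable [CompactSpace X] [∀ x : X, NeBot (𝓝[≠] x)] [CompactSpace Y]

/-- The points from which the next stage is built, with a finite group connecting them. -/
theorem Stage.exists_isPlacement [T1Space X] (hΓ : IsAmple Γ) (hmin : IsMinimal Γ)
    (st : Stage Γ D q) (hq' : IsBlockMap H' q') {V : Subgroup (X ≃ₜ X)}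
    (hV : (V : Set (X ≃ₜ X)).Finite) (hVΓ : V ≤ Γ) {C : Set X} (hCo : IsOpen C)
    (hC : C.Nonempty) (L : ℕ) (x₀ : X) :
    ∃ (J : Type v) (key : Set J) (z : J → X) (pt : J → Y) (W : Subgroup (X ≃ₜ X)),
      IsPlacement st H q' V key z pt ∧ (W : Set (X ≃ₜ X)).Finite ∧ W ≤ Γ ∧ V ≤ W ∧
      (∀ j, ∃ w ∈ W, w x₀ = z j) ∧ (∀ x, ∃ w ∈ W, w x ∈ C) ∧
      ∀ y, ∃ e : Fin L → J, Function.Injective e ∧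
        ∀ i, e i ∉ key ∧ q' (pt (e i)) = q' y ∧ z (e i) ∈ C := by
  classical
  have hfin : (range q').Finite := hq'.locConst.range_finite
  have hfin' : (range fun y => saturation H (q' y)).Finite :=
    (hq'.locConst.comp (saturation H)).range_finite
  have : Finite (range q') := hfin.to_subtype
  have : Finite (range fun y => saturation H (q' y)) := hfin'.to_subtype
  -- The left summand indexes the key points, one for each `H`-orbit of blocks of `q'`; the right
  -- one gives `L` further points of each colour.
  let J := (range fun y => saturation H (q' y)) ⊕ (range q' × Fin L)
  let pt : J → Y := Sum.elim (fun r => r.2.choose) (fun b => b.1.2.choose)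
  have hpt1 : ∀ r : range fun y => saturation H (q' y),
      saturation H (q' (pt (Sum.inl r))) = r := fun r => r.2.choose_spec
  have hpt2 : ∀ b : range q' × Fin L, q' (pt (Sum.inr b)) = b.1 := fun b => b.1.2.choose_spec
  let A : J → Set X := Sum.elim (fun r => {x | st.lab x = q (pt (Sum.inl r))}) (fun _ => C)
  obtain ⟨γ, hγ, hγA, hsep⟩ := hmin.exists_separated hV x₀ A
    (by
      rintro (r | b)
      · exact st.lab_locConst.isOpen_fiber _
      · exact hCo)
    (by
      rintro (r | b)
      · exact st.exists_lab_eq _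
      · exact hC)
  obtain ⟨t, ht, htΓ, htC⟩ := hmin.exists_finite_cover hCo hC
  let gen : Set (X ≃ₜ X) := V ∪ (range γ ∪ t)
  have hgen : gen ⊆ Γ := union_subset hVΓ (union_subset (range_subset_iff.2 hγ) htΓ)
  refine ⟨J, range Sum.inl, fun j => γ j x₀, pt, Subgroup.closure gen, ⟨?_, ?_, ?_, hsep⟩,
    hΓ.locallyFinite gen (hV.union ((finite_range γ).union ht)) hgen,
    (Subgroup.closure_le Γ).2 hgen, fun v hv => Subgroup.subset_closure (Or.inl hv),
    fun j => ⟨γ j, Subgroup.subset_closure (Or.inr (Or.inl ⟨j, rfl⟩)), rfl⟩, fun x => ?_,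
    fun y => ⟨fun i => Sum.inr (⟨q' y, mem_range_self y⟩, i), ?_, fun i => ⟨?_, hpt2 _,
      hγA (Sum.inr (⟨q' y, mem_range_self y⟩, i))⟩⟩⟩
  · rintro _ ⟨r, rfl⟩
    exact hγA (Sum.inl r)
  · rintro _ ⟨r, rfl⟩ _ ⟨r', rfl⟩ h
    rw [hpt1, hpt1] at h
    rw [Subtype.ext h]
  · intro y
    exact ⟨_, ⟨⟨_, mem_range_self y⟩, rfl⟩, hpt1 ⟨_, mem_range_self y⟩⟩
  · obtain ⟨w, hw, hwx⟩ := htC x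
    exact ⟨w, Subgroup.subset_closure (Or.inr (Or.inr hw)), hwx⟩
  · intro i j h
    exact (Prod.ext_iff.1 (Sum.inr_injective h)).2
  · rintro ⟨r, hr⟩
    exact Sum.inl_ne_inr hr

/-- The labels and colours placed on the orbit of `x₀` are spread over a thin tower; off the tower
there are no labels, and all colours are equal. -/
theorem Stage.exists_isStep [T2Space X] [TotallyDisconnectedSpace X] [Nonempty X] [Nonempty Y]
    (hΓ : IsAmple Γ) (hmin : IsMinimal Γ) (st : Stage Γ D q) (hq : IsBlockMap H q)
    (hq' : IsBlockMap H' q') (hH : H ≤ H') (hqq : ∀ y, q' y ⊆ q y)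
    (hD : D ≤ H) (hDD : D ≤ D') (hD' : D' ≤ H') {σ : X ≃ₜ X} (hσ : σ ∈ Γ) {C : Set X}
    (hCc : IsClopen C) (hC : C.Nonempty) (N : ℕ) :
    ∃ st' : Stage Γ D' q', IsStep st st' H H' σ C N := by
  classical
  obtain ⟨x₀⟩ := ‹Nonempty X›
  obtain ⟨y₀⟩ := ‹Nonempty Y›
  let V : Subgroup (X ≃ₜ X) := Subgroup.closure (insert σ (st.W : Set (X ≃ₜ X)))
  have hgen : insert σ (st.W : Set (X ≃ₜ X)) ⊆ Γ := insert_subset hσ st.le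
  have hV : (V : Set (X ≃ₜ X)).Finite := hΓ.locallyFinite _ (st.finite.insert σ) hgen
  have hVΓ : V ≤ Γ := (Subgroup.closure_le Γ).2 hgen
  have hWV : st.W ≤ V := fun w hw => Subgroup.subset_closure (Or.inr hw)
  have hσV : σ ∈ V := Subgroup.subset_closure (Or.inl rfl)
  -- One point more than thinness requires, so that every colour reaches `C` even for `N = 0`.
  obtain ⟨J, key, z, pt, W, hp, hW, hWΓ, hVW, hzW, hWC, hfree⟩ :=
    st.exists_isPlacement hΓ hmin hq' hV hVΓ hCc.isOpen hC (N * (range q').ncard + 1) x₀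
  obtain ⟨j₀, hj₀, -⟩ := hp.key_exists y₀
  have hCl : IsLocallyConstant fun x => x ∈ C := by
    rw [IsLocallyConstant.iff_eventually_eq]
    intro x
    by_cases hx : x ∈ C
    · exact eventually_of_mem (hCc.isOpen.mem_nhds hx) fun y hy => propext (iff_of_true hy hx)
    · exact eventually_of_mem (hCc.compl.isOpen.mem_nhds hx)
        fun y hy => propext (iff_of_false hy hx)
  obtain ⟨Z, τ, hT, hτ⟩ := exists_isTower hΓ hWΓ hW
    (st.lab_locConst.prodMk (st.col_locConst.prodMk hCl)) x₀
  have hτl : ∀ x ∈ Z, st.lab (τ x) = st.lab x := fun x hx => congrArg Prod.fst (hτ x hx)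
  have hτc : ∀ x ∈ Z, st.col (τ x) = st.col x :=
    fun x hx => congrArg (fun p => p.2.1) (hτ x hx)
  have hτC : ∀ x ∈ Z, (τ x ∈ C) = (x ∈ C) := fun x hx => congrArg (fun p => p.2.2) (hτ x hx)
  let f : X → Set Y := newLab st H q' key z pt
  let g : X → Set Y := newCol st H D' q' V key z pt j₀
  let lab : X → Set Y := fun x => if x ∈ Z then f (τ x) else ∅
  let col : X → Set Y := fun x => if x ∈ Z then g (τ x) else ∅
  have hlab : ∀ x ∈ Z, lab x = f (τ x) := fun x hx => if_pos hx
  have hcol : ∀ x ∈ Z, col x = g (τ x) := fun x hx => if_pos hx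
  have hcol' : ∀ x, x ∉ Z → col x = ∅ := fun x hx => if_neg hx
  have hlabZ : ∀ x, (lab x).Nonempty → x ∈ Z := by
    intro x hx
    by_contra h
    simp [lab, h] at hx
  have hcolZ : ∀ x, (col x).Nonempty → x ∈ Z := by
    intro x hx
    by_contra h
    simp [col, h] at hx
  have hZW : ∀ w ∈ W, ∀ x, x ∉ Z → w x ∉ Z := by
    intro w hw x hx h
    apply hx
    have := hT.smul_mem w⁻¹ (W.inv_mem hw) _ h
    rwa [show w⁻¹ (w x) = x from w.symm_apply_apply x] at this
  have hlc : ∀ φ : X → Set Y, IsLocallyConstant fun x => if x ∈ Z then φ (τ x) else ∅ := by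
    intro φ
    rw [IsLocallyConstant.iff_eventually_eq]
    intro x
    by_cases hx : x ∈ Z
    · filter_upwards [hT.isClopen.isOpen.mem_nhds hx, hT.locConst.eventually_eq x] with y hy hy'
      rw [if_pos hx, if_pos hy, hy']
    · filter_upwards [hT.isClopen.compl.isOpen.mem_nhds hx] with y hy
      rw [if_neg hx, if_neg hy]
  -- The points of the orbit of `x₀` as translates of `τ x`.
  have htrans : ∀ x ∈ Z, ∀ w ∈ W, ∃ v ∈ W, v x ∈ Z ∧ τ (v x) = w x₀ := by
    intro x hx w hw
    obtain ⟨u, hu, hux⟩ := hT.exists_eq x hx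
    refine ⟨w * u⁻¹, W.mul_mem hw (W.inv_mem hu), hT.smul_mem _ (W.mul_mem hw (W.inv_mem hu)) x hx,
      ?_⟩
    rw [hT.smul _ (W.mul_mem hw (W.inv_mem hu)) x hx, hux]
    exact congrArg w (u.symm_apply_apply x₀)
  have hfsurj : ∀ y, ∃ w ∈ W, f (w x₀) = q' y := by
    intro y
    obtain ⟨j, -, w, hw, h⟩ := hp.exists_newLab_eq hq hq' hH hqq hD hWV y
    obtain ⟨v, hv, hvz⟩ := hzW j
    exact ⟨w * v, W.mul_mem (hVW (hWV hw)) hv, by rw [← h, ← hvz]; rfl⟩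
  have hfcoarse : ∀ x ∈ Z, ∀ y, st.Coarse H x y → y ∈ Z ∧ st.Coarse H (τ x) (τ y) := by
    rintro x hx y ⟨⟨w, hw, rfl⟩, h⟩
    have hy := hT.smul_mem w (hVW (hWV hw)) x hx
    exact ⟨hy, ⟨w, hw, (hT.smul w (hVW (hWV hw)) x hx).symm⟩, by rw [hτc x hx, hτc _ hy, h]⟩
  have hffine : ∀ x ∈ Z, ∀ y, st.Fine x y → y ∈ Z ∧ st.Fine (τ x) (τ y) := by
    rintro x hx y ⟨⟨w, hw, rfl⟩, h⟩
    have hy := hT.smul_mem w (hVW (hWV hw)) x hx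
    exact ⟨hy, ⟨w, hw, (hT.smul w (hVW (hWV hw)) x hx).symm⟩, by rw [hτc x hx, hτc _ hy, h]⟩
  have hgf : ∀ x, (f x).Nonempty → g x = saturation D' (f x) := fun x hx =>
    IsPlacement.newCol_of_fine hq hq' hH hD hDD (Stage.Fine.refl x) hx
  let st' : Stage Γ D' q' :=
    { W := W
      finite := hW
      le := hWΓ
      col := col
      lab := lab
      col_locConst := hlc g
      lab_locConst := hlc f
      lab_cases := by
        intro x hx
        have hxZ := hlabZ x hx
        rw [hlab x hxZ] at hx ⊢
        exact hp.exists_newLab_of_nonempty hq hq' hH hqq hWV hx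
      col_cases := by
        intro x hx
        rw [hcol x (hcolZ x hx)]
        exact hp.exists_newCol hq hq' hH hqq hWV _
      col_of_lab := by
        intro x hx
        have hxZ := hlabZ x hx
        rw [hlab x hxZ] at hx
        rw [hcol x hxZ, hlab x hxZ]
        exact hgf _ hx
      inj := by
        intro w hw x hx h
        have hxZ := hlabZ x hx
        rw [hlab x hxZ] at hx
        rw [hlab x hxZ, hlab _ (hT.smul_mem w hw x hxZ)] at h
        exact hT.free w hw x hxZ (hp.newLab_injective hq hx h)
      surj := by
        intro x hx y
        obtain ⟨w, hw, h⟩ := hfsurj y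
        obtain ⟨v, hv, hvZ, hvx⟩ := htrans x (hcolZ x hx) w hw
        exact ⟨v, hv, by rw [hlab _ hvZ, hvx, h]⟩
      exists_col := by
        obtain ⟨y, hy⟩ := hp.exists_newCol (D' := D') (j₀ := j₀) hq hq' hH hqq hWV (τ x₀)
        refine ⟨x₀, ?_⟩
        rw [hcol _ hT.base_mem, show g (τ x₀) = _ from hy, saturation_nonempty]
        exact ⟨y, hq'.mem_self y⟩ }
  have hVcoarse : ∀ v ∈ V, ∀ x, st'.Coarse H' x (v x) := by
    intro v hv x
    refine ⟨⟨v, hVW hv, rfl⟩, ?_⟩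
    show saturation H' (col x) = saturation H' (col (v x))
    by_cases hx : x ∈ Z
    · rw [hcol x hx, hcol _ (hT.smul_mem v (hVW hv) x hx), hT.smul v (hVW hv) x hx]
      exact (hp.saturation_newCol_smul hq hq' hH hqq hD hDD hD' hWV hv _).symm
    · rw [hcol' x hx, hcol' _ (hZW v (hVW hv) x hx)]
  have hempty : ∀ x, x ∉ Z → ∀ w ∈ W, st'.Fine x (w x) := fun x hx w hw =>
    ⟨⟨w, hw, rfl⟩, (hcol' x hx).trans (hcol' _ (hZW w hw x hx)).symm⟩
  refine ⟨st', ⟨fun w hw => hVW (hWV hw), fun w hw => hVcoarse w (hWV hw), hVcoarse σ hσV,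
    ?_, ?_, ?_, ?_, ?_, ?_, ?_⟩⟩
  · intro x y h
    obtain ⟨w, hw, hwy⟩ := h.1
    by_cases hx : x ∈ Z
    · refine ⟨⟨w, hVW (hWV hw), hwy⟩, ?_⟩
      obtain ⟨hy, h'⟩ := hffine x hx y h
      exact (hcol x hx).trans ((hp.newCol_fine hq hq' hH hD hDD hWV h').trans (hcol y hy).symm)
    · rw [← hwy]
      exact hempty x hx w (hVW (hWV hw))
  · intro x y hy
    have hx : x ∈ Z := hlabZ x ⟨y, hy⟩
    rw [← hτl x hx]
    have hy' : y ∈ lab x := hy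
    rw [hlab x hx] at hy'
    exact IsPlacement.newLab_subset hq _ hy'
  · intro x y h s hs hxy
    by_cases hx : x ∈ Z
    · obtain ⟨hy, h'⟩ := hfcoarse x hx y h
      show lab y = s '' lab x
      rw [hlab x hx, hlab y hy]
      exact IsPlacement.newLab_image hq hq' hH h' hs (by rw [hτl x hx, hτl y hy, hxy])
    · have hy : y ∉ Z := by
        obtain ⟨w, hw, rfl⟩ := h.1
        exact hZW w (hVW (hWV hw)) x hx
      show lab y = s '' lab x
      simp [lab, hx, hy]
  · intro x y h
    obtain ⟨w, hw, hwy⟩ := h.1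
    by_cases hx : x ∈ Z
    · obtain ⟨hy, h'⟩ := hfcoarse x hx y h
      rcases hp.newCol_coarse (D' := D') (j₀ := j₀) hWV h' with h1 | ⟨u, hu, hu'⟩
      · exact Or.inl ⟨⟨w, hVW (hWV hw), hwy⟩, (hcol x hx).trans (h1.trans (hcol y hy).symm)⟩
      · right
        obtain ⟨⟨v, hv, rfl⟩, hvc⟩ := hu
        have hvx := hT.smul_mem v (hVW (hWV hv)) x hx
        have hτv := hT.smul v (hVW (hWV hv)) x hx
        refine ⟨v x, ⟨⟨v, hv, rfl⟩, ?_⟩, ?_⟩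
        · rw [← hτc x hx, ← hτc _ hvx, hτv, hvc]
        · show (lab (v x)).Nonempty
          rw [hlab _ hvx, hτv]
          exact hu'
    · left
      rw [← hwy]
      exact hempty x hx w (hVW (hWV hw))
  · intro x y hx hxy hxC
    have hxZ := hlabZ x hx
    have hyZ : y ∈ Z := hlabZ y (by rw [show lab y = lab x from hxy.symm]; exact hx)
    have hx' : (lab x).Nonempty := hx
    have hxy' : lab x = lab y := hxy
    rw [hlab x hxZ] at hx' hxy'
    rw [hlab y hyZ] at hxy'
    have h1 : τ y = τ x := hp.newLab_injective hq hx' hxy'.symm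
    rw [← hτC y hyZ, h1, hτC x hxZ]
    exact hxC
  · intro x
    by_cases hx : x ∈ Z
    · obtain ⟨y, hy⟩ := hp.exists_newCol (D' := D') (j₀ := j₀) hq hq' hH hqq hWV (τ x)
      obtain ⟨e, -, he⟩ := hfree y
      obtain ⟨hk, hb, hzC⟩ := he 0
      obtain ⟨w, hw, hwz⟩ := hzW (e 0)
      obtain ⟨v, hv, hvZ, hvx⟩ := htrans x hx w hw
      rw [hwz] at hvx
      refine ⟨v x, by rw [← hτC _ hvZ, hvx]; exact hzC, ⟨v, hv, rfl⟩, ?_⟩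
      show col x = col (v x)
      rw [hcol x hx, hcol _ hvZ, hvx, show g (τ x) = _ from hy,
        show g (z (e 0)) = _ from hp.newCol_of_notMem hWV hk, hb]
    · obtain ⟨w, hw, hwC⟩ := hWC x
      exact ⟨w x, hwC, hempty x hx w hw⟩
  · intro y
    obtain ⟨e, he, hek⟩ := hfree y
    obtain ⟨u, hu, hfu⟩ := hfsurj y
    have hune : (f (u x₀)).Nonempty := by
      rw [hfu]
      exact ⟨y, hq'.mem_self y⟩
    let A : Set X := {x | lab x = q' y}
    have hA : IsClopen A := (hlc f).isClopen_fiber _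
    have hAx : ∀ x ∈ A, x ∈ Z ∧ τ x = u x₀ := by
      intro x hx
      have hx' : lab x = q' y := hx
      have hxZ : x ∈ Z := hlabZ x (by rw [hx']; exact ⟨y, hq'.mem_self y⟩)
      rw [hlab x hxZ, ← hfu] at hx'
      exact ⟨hxZ, hp.newLab_injective hq hune hx'⟩
    have hex : ∀ j, ∃ γ ∈ Γ, (∀ x, st'.Fine x (γ x)) ∧ ∀ x ∈ A, γ x ∈ Z ∧ τ (γ x) = z (e j) := by
      intro j
      obtain ⟨v, hv, hvz⟩ := hzW (e j)
      have hw : v * u⁻¹ ∈ W := W.mul_mem hv (W.inv_mem hu)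
      have hwA : ∀ x ∈ A, (v * u⁻¹) x ∈ Z ∧ τ ((v * u⁻¹) x) = z (e j) := by
        intro x hx
        obtain ⟨hxZ, hτx⟩ := hAx x hx
        refine ⟨hT.smul_mem _ hw x hxZ, ?_⟩
        rw [hT.smul _ hw x hxZ, hτx, ← hvz]
        exact congrArg v (u.symm_apply_apply x₀)
      have hd : Disjoint A ((v * u⁻¹ : X ≃ₜ X) '' A) := by
        rw [Set.disjoint_left]
        rintro _ h1 ⟨x, hx, rfl⟩
        have h2 := (hAx _ h1).2
        rw [(hwA x hx).2] at h2
        refine hp.not_coarse_of_notMem hWV (hek j).1 (Stage.Coarse.refl _) ?_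
        rw [h2]
        exact hune
      have hc : ∀ x ∈ A, st'.col ((v * u⁻¹) x) = st'.col x := by
        intro x hx
        obtain ⟨hxZ, hτx⟩ := hAx x hx
        obtain ⟨h1, h2⟩ := hwA x hx
        show col _ = col x
        rw [hcol _ h1, hcol x hxZ, h2, hτx, hgf _ hune, hfu,
          show g (z (e j)) = _ from hp.newCol_of_notMem hWV (hek j).1, (hek j).2.1]
      obtain ⟨γ, hγ, h1, h2⟩ := st'.exists_swap hΓ.full hw hA hd hc
      exact ⟨γ, hγ, h1, fun x hx => by rw [h2 x hx]; exact hwA x hx⟩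
    choose γ hγ hγf hγA using hex
    refine ⟨fun j => γ j.castSucc, fun j => ⟨hγ _, hγf _⟩, fun i j hij => ?_⟩
    refine Set.disjoint_left.2 ?_
    rintro _ ⟨x, hx, rfl⟩ ⟨x', hx', h⟩
    have h1 : τ (γ i.castSucc x) = z (e i.castSucc) := (hγA _ x hx).2
    rw [← show γ j.castSucc x' = γ i.castSucc x from h, (hγA _ x' hx').2] at h1
    have h2 := he (hp.separated 1 V.one_mem _ _ h1)
    exact hij (Fin.castSucc_injective _ h2).symm

end Step

/-! ### Groups induced on a copy of a space -/

section Induced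

theorem subset_fullHull {X : Type*} [TopologicalSpace X] (G : Subgroup (X ≃ₜ X)) :
    (G : Set (X ≃ₜ X)) ⊆ fullHull G := fun g hg =>
  ⟨1, fun _ => univ, fun _ => g, fun _ => isClopen_univ,
    fun i j hij => (hij (Subsingleton.elim i j)).elim, iUnion_const _, fun _ => hg,
    fun _ _ _ => rfl⟩

variable {X Y : Type*} [TopologicalSpace X] [TopologicalSpace Y]
  [CompactSpace Y] [T2Space Y] [TotallyDisconnectedSpace Y]

theorem mem_map_conjHomeo_of_locally {H : Subgroup (Y ≃ₜ Y)} (hH : IsFull H) {K : Set X}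
    {h : Y ≃ₜ K} {g : K ≃ₜ K} (hg : ∀ y, ∃ s ∈ H, ∀ᶠ y' in 𝓝 y, g (h y') = h (s y')) :
    g ∈ H.map (conjHomeo h) := by
  refine ⟨(h.trans g).trans h.symm, hH.mem_of_locally fun y => ?_, ?_⟩
  · obtain ⟨s, hs, hev⟩ := hg y
    refine ⟨s, hs, hev.mono fun y' hy' => ?_⟩
    show h.symm (g (h y')) = s y'
    rw [hy', h.symm_apply_apply]
  · ext x
    show ((h (h.symm (g (h (h.symm x)))) : K) : X) = g x
    rw [h.apply_symm_apply, h.apply_symm_apply]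

/-- A homeomorphism `h : Y ≃ₜ K` conjugates `H` to the group induced by `G` on `K` as soon as
the partial maps of `K` given locally by elements of `H` and of `G` are the same. -/
theorem map_conjHomeo_eq_inducedGroup [CompactSpace X] [T2Space X]
    [TotallyDisconnectedSpace X] {G : Subgroup (X ≃ₜ X)} (hG : IsFull G)
    {H : Subgroup (Y ≃ₜ Y)} (hH : IsAmple H) {K : Set X} (hK : IsClosed K)
    (hE : IsEtale G K) (h : Y ≃ₜ K)
    (h1 : ∀ γ ∈ G, ∀ y, γ (h y) ∈ K → ∃ s ∈ H, ∀ᶠ y' in 𝓝 y, γ (h y') = h (s y'))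
    (h2 : ∀ s ∈ H, ∀ y, ∃ γ ∈ G, ∀ᶠ y' in 𝓝 y, γ (h y') = h (s y')) :
    H.map (conjHomeo h) = inducedGroup G K := by
  have : CompactSpace K := h.compactSpace
  apply le_antisymm
  · rintro _ ⟨s, hs, rfl⟩
    refine (isFull_inducedGroup G K).mem_of_locally fun x => ?_
    obtain ⟨y, rfl⟩ := h.surjective x
    have hconj : ∀ y', conjHomeo h s (h y') = h (s y') := fun y' =>
      congrArg (fun z => h (s z)) (h.symm_apply_apply y')
    have htr : ∀ P : K → Prop, (∀ᶠ y' in 𝓝 y, P (h y')) → ∀ᶠ x in 𝓝 (h y), P x := by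
      intro P hP
      rwa [← h.map_nhds_eq y]
    by_cases hsy : s y = y
    · refine ⟨1, Subgroup.one_mem _, htr _ ?_⟩
      filter_upwards [(hH.clopen_fixed s hs).isOpen.mem_nhds hsy] with y' hy'
      rw [hconj, show s y' = y' from hy']
      rfl
    · obtain ⟨γ, hγ, hev⟩ := h2 s hs y
      have hne : γ (h y) ≠ (h y : X) := by
        rw [hev.self_of_nhds]
        exact fun e => hsy (h.injective (Subtype.ext e))
      obtain ⟨A, B, hA, hB, hxA, hxB, hAB⟩ := t2_separation hne
      obtain ⟨U, hU, hxU, hUs⟩ := compact_exists_isClopen_in_isOpen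
        (hB.inter (hA.preimage γ.continuous)) ⟨hxB, hxA⟩
      have hd : Disjoint U (γ '' U) := by
        rw [Set.disjoint_left]
        rintro _ h3 ⟨z, hz, rfl⟩
        exact Set.disjoint_left.1 hAB (hUs hz).2 (hUs h3).1
      obtain ⟨δ, hδ, hδ2, hδU, -, -⟩ := hG.exists_swap hγ hU hd
      obtain ⟨g, hg⟩ := exists_homeomorph_inducedMap hE hδ hδ2
      refine ⟨g, Subgroup.mem_sInf.2 fun L hL => hL.2 δ hδ hδ2 g hg, htr _ ?_⟩
      have hc : Continuous fun y' => (h y' : X) := continuous_subtype_val.comp h.continuous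
      filter_upwards [(hU.isOpen.preimage hc).mem_nhds hxU, hev] with y' hy' hy''
      have h3 : δ (h y') = h (s y') := (hδU _ hy').trans hy''
      have h4 : δ (h y') ∈ K := by
        rw [h3]
        exact (h (s y')).2
      rw [hconj, hg, inducedMap, dif_pos h4]
      exact Subtype.ext h3.symm
  · refine sInf_le ⟨?_, ?_⟩
    · refine Subset.antisymm (subset_fullHull _) ?_
      rintro g ⟨n, U, φ, hU, -, hun, hφ, hg⟩
      refine mem_map_conjHomeo_of_locally hH.full fun y => ?_
      obtain ⟨i, hi⟩ := mem_iUnion.1 (hun.symm ▸ mem_univ (h y))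
      obtain ⟨s, hs, hsφ⟩ := hφ i
      refine ⟨s, hs, ?_⟩
      filter_upwards [((hU i).isOpen.preimage h.continuous).mem_nhds hi] with y' hy'
      rw [hg i _ hy', ← hsφ]
      exact congrArg (fun z => h (s z)) (h.symm_apply_apply y')
    · intro γ hγ _ g hg
      refine mem_map_conjHomeo_of_locally hH.full fun y => ?_
      by_cases hy : γ (h y) ∈ K
      · obtain ⟨s, hs, hev⟩ := h1 γ hγ y hy
        refine ⟨s, hs, hev.mono fun y' hy' => ?_⟩
        have hm : γ (h y') ∈ K := by
          rw [hy']
          exact (h (s y')).2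
        rw [hg, inducedMap, dif_pos hm]
        exact Subtype.ext hy'
      · refine ⟨1, H.one_mem, ?_⟩
        have hc : Continuous fun y' => γ (h y') :=
          γ.continuous.comp (continuous_subtype_val.comp h.continuous)
        filter_upwards [(hK.isOpen_compl.preimage hc).mem_nhds hy] with y' hy'
        rw [hg, inducedMap, dif_neg hy']
        rfl

end Induced

/-! ### The limit of a sequence of stages -/

section Limit

variable {X Y : Type*} [TopologicalSpace X] [TopologicalSpace Y]
  {Γ : Subgroup (X ≃ₜ X)} {S Δ : Subgroup (Y ≃ₜ Y)} {H : ℕ → Subgroup (Y ≃ₜ Y)}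
  {q : ℕ → Y → Set Y} {st : ∀ m, Stage Γ (H m ⊓ Δ) (q m)}

/-- A sequence of stages, each refining its predecessor, in which every element of `Γ` and every
nonempty clopen set is treated at some step. -/
structure IsStageSequence (H : ℕ → Subgroup (Y ≃ₜ Y)) (st : ∀ m, Stage Γ (H m ⊓ Δ) (q m))
    (σ : ℕ → (X ≃ₜ X)) (C : ℕ → Set X) : Prop where
  step : ∀ m, IsStep (st m) (st (m + 1)) (H m) (H (m + 1)) (σ m) (C m) m
  exhaust : ∀ γ ∈ Γ, ∃ m, σ m = γ
  clopen : ∀ U : Set X, IsClopen U → U.Nonempty → ∃ m, C m = U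

/-- The set of points that carry a label at all stages. -/
def copy (st : ∀ m, Stage Γ (H m ⊓ Δ) (q m)) : Set X := {x | ∀ m, ((st m).lab x).Nonempty}

theorem isClosed_copy : IsClosed (copy st) := by
  have h : copy st = ⋂ m, {x | ((st m).lab x).Nonempty} := by
    ext x
    simp [copy]
  rw [h]
  refine isClosed_iInter fun m => ?_
  have h1 : IsClopen {x | (((st m).lab x).Nonempty) = True} :=
    ((st m).lab_locConst.comp Set.Nonempty).isClopen_fiber True
  simpa using h1.isClosed

theorem IsFiltration.lab_eq (hF : IsFiltration S H q) {m : ℕ} {x : X} {y : Y}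
    (h : y ∈ (st m).lab x) : (st m).lab x = q m y := by
  obtain ⟨z, hz⟩ := (st m).lab_cases x ⟨y, h⟩
  rw [hz] at h ⊢
  exact ((hF.isBlockMap m).eq_of_mem z y h).symm

theorem IsFiltration.ext (hF : IsFiltration S H q) [CompactSpace Y] [T2Space Y]
    [TotallyDisconnectedSpace Y] {y y' : Y} (h : ∀ m, q m y = q m y') : y = y' := by
  by_contra hne
  obtain ⟨U, hU, hyU, hUs⟩ := compact_exists_isClopen_in_isOpen (isOpen_compl_singleton (x := y'))
    (show y ∈ ({y'}ᶜ : Set Y) from hne)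
  obtain ⟨m, hm⟩ := hF.separating U hU
  have h1 : y' ∈ q m y := by
    rw [h m]
    exact (hF.isBlockMap m).mem_self y'
  exact hUs (hm y hyU h1) rfl

variable {σ : ℕ → (X ≃ₜ X)} {C : ℕ → Set X}

namespace IsStageSequence

variable (hF : IsFiltration S H q) (hst : IsStageSequence H st σ C)

include hst

theorem fine_mono {m n : ℕ} (hmn : m ≤ n) {x y : X} (h : (st m).Fine x y) : (st n).Fine x y := by
  induction n, hmn using Nat.le_induction with
  | base => exact h
  | succ n _ ih => exact (hst.step n).fine x y ih

theorem coarse_mono {m n : ℕ} (hmn : m ≤ n) {x y : X} (h : (st m).Coarse (H m) x y) :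
    (st n).Coarse (H n) x y := by
  induction n, hmn using Nat.le_induction with
  | base => exact h
  | succ n _ ih =>
    obtain ⟨w, hw, rfl⟩ := ih.1
    exact (hst.step n).coarse_smul w hw x

theorem lab_anti {m n : ℕ} (hmn : m ≤ n) (x : X) : (st n).lab x ⊆ (st m).lab x := by
  induction n, hmn using Nat.le_induction with
  | base => exact Subset.rfl
  | succ n _ ih => exact ((hst.step n).lab_subset x).trans ih

theorem exists_coarse {γ : X ≃ₜ X} (hγ : γ ∈ Γ) : ∃ m, ∀ x, (st m).Coarse (H m) x (γ x) := by
  obtain ⟨m, rfl⟩ := hst.exhaust γ hγ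
  exact ⟨m + 1, (hst.step m).coarse_apply⟩

/-- The union over all stages of the subgroups of `Γ` whose elements move points inside fine
classes. -/
def limitGroup : Subgroup (X ≃ₜ X) where
  carrier := {γ | γ ∈ Γ ∧ ∃ m, ∀ x, (st m).Fine x (γ x)}
  one_mem' := ⟨Γ.one_mem, 0, fun x => Stage.Fine.refl x⟩
  mul_mem' := by
    rintro a b ⟨ha, m, hm⟩ ⟨hb, n, hn⟩
    exact ⟨Γ.mul_mem ha hb, max m n, fun x =>
      (hst.fine_mono (le_max_right m n) (hn x)).trans
        (hst.fine_mono (le_max_left m n) (hm (b x)))⟩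
  inv_mem' := by
    rintro a ⟨ha, m, hm⟩
    refine ⟨Γ.inv_mem ha, m, fun x => ?_⟩
    have h := (hm (a⁻¹ x)).symm
    rwa [show a (a⁻¹ x) = x from a.apply_symm_apply x] at h

theorem limitGroup_le : hst.limitGroup ≤ Γ := fun _ h => h.1

theorem isAmple_limitGroup (hΓ : IsAmple Γ) : IsAmple hst.limitGroup where
  countable := hΓ.countable.mono hst.limitGroup_le
  locallyFinite s hs h := hΓ.locallyFinite s hs (h.trans hst.limitGroup_le)
  clopen_fixed γ h := hΓ.clopen_fixed γ h.1
  full := by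
    refine Subset.antisymm (subset_fullHull _) ?_
    rintro g ⟨n, U, γ, hU, hd, hun, hγ, hg⟩
    have hgΓ : g ∈ (Γ : Set (X ≃ₜ X)) := by
      rw [hΓ.full]
      exact ⟨n, U, γ, hU, hd, hun, fun i => (hγ i).1, hg⟩
    choose m hm using fun i => (hγ i).2
    refine ⟨hgΓ, Finset.univ.sup m, fun x => ?_⟩
    obtain ⟨i, hi⟩ := mem_iUnion.1 (hun.symm ▸ mem_univ x)
    rw [hg i x hi]
    exact hst.fine_mono (Finset.le_sup (Finset.mem_univ i)) (hm i x)

theorem isMinimal_limitGroup [CompactSpace X] [T2Space X] [TotallyDisconnectedSpace X]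
    (hΓ : IsAmple Γ) : IsMinimal hst.limitGroup := by
  intro x
  rw [dense_iff_inter_open]
  rintro U hU ⟨u, hu⟩
  obtain ⟨V, hV, huV, hVU⟩ := compact_exists_isClopen_in_isOpen hU hu
  obtain ⟨m, rfl⟩ := hst.clopen V hV ⟨u, huV⟩
  obtain ⟨_, hy, ⟨w, hw, rfl⟩, hc⟩ := (hst.step m).dense x
  obtain ⟨γ, hγ, hf, hev⟩ := (st (m + 1)).exists_mem_eventuallyEq hΓ hw hc.symm
  exact ⟨w x, hVU hy, γ, ⟨hγ, m + 1, hf⟩, hev.self_of_nhds⟩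

theorem eq_of_lab_eq [CompactSpace X] [T2Space X] [TotallyDisconnectedSpace X] {x x' : X}
    (hx : x ∈ copy st) (h : ∀ m, (st m).lab x = (st m).lab x') : x = x' := by
  by_contra hne
  obtain ⟨U, hU, hxU, hUs⟩ := compact_exists_isClopen_in_isOpen (isOpen_compl_singleton (x := x'))
    (show x ∈ ({x'}ᶜ : Set X) from hne)
  obtain ⟨m, rfl⟩ := hst.clopen U hU ⟨x, hxU⟩
  exact hUs ((hst.step m).separates x x' (hx (m + 1)) (h (m + 1)) hxU) rfl

include hF

/-- If the labels of coarsely related points are translates by `s` at one stage, then they are so at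
all later stages. -/
theorem lab_image_of_le {m n : ℕ} (hmn : m ≤ n) {x y : X} (h : (st m).Coarse (H m) x y)
    {s : Y ≃ₜ Y} (hs : s ∈ H m) (hxy : (st m).lab y = s '' (st m).lab x) :
    (st n).lab y = s '' (st n).lab x := by
  induction n, hmn using Nat.le_induction with
  | base => exact hxy
  | succ n hn ih =>
    exact (hst.step n).lab_image x y (hst.coarse_mono hn h) s (hF.mono hn hs) ih

/-- A labelled point related to a point of the copy keeps its label at all stages. -/
theorem mem_copy {m : ℕ} {x y : X} (h : (st m).Coarse (H m) x y) (hx : x ∈ copy st)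
    (hy : ((st m).lab y).Nonempty) : y ∈ copy st := by
  obtain ⟨s, hs, hxy⟩ := h.exists_image inf_le_left (hF.isBlockMap m) (hx m) hy
  intro n
  have h1 := hst.lab_image_of_le hF (le_max_left m n) h hs hxy
  refine Nonempty.mono (hst.lab_anti (le_max_right m n) y) ?_
  rw [h1]
  exact (hx _).image s

/-- The labels identify the space `Y` with the set of points that carry a label at all stages. -/
theorem exists_homeomorph [CompactSpace X] [T2Space X] [TotallyDisconnectedSpace X]
    [CompactSpace Y] [T2Space Y] [TotallyDisconnectedSpace Y] :
    ∃ h : Y ≃ₜ copy st, ∀ y m, (st m).lab (h y) = q m y := by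
  have hclosed : ∀ m y, IsClosed (q m y) := by
    intro m y
    have : q m y = {z | q m z = q m y} := by
      ext z
      refine ⟨(hF.isBlockMap m).eq_of_mem y z, fun h => ?_⟩
      rw [← show q m z = q m y from h]
      exact (hF.isBlockMap m).mem_self z
    rw [this]
    exact (hF.isBlockMap m).locConst.isClosed_fiber _
  have h1 : ∀ x : copy st, ∃ y, ∀ m, (st m).lab x = q m y := by
    intro x
    have hcl : ∀ m, IsClosed ((st m).lab x) := by
      intro m
      obtain ⟨y, hy⟩ := (st m).lab_cases x (x.2 m)
      rw [hy]
      exact hclosed m y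
    obtain ⟨y, hy⟩ := IsCompact.nonempty_iInter_of_sequence_nonempty_isCompact_isClosed
      (fun m => (st m).lab x) (fun m => hst.lab_anti (Nat.le_succ m) x) x.2 (hcl 0).isCompact hcl
    exact ⟨y, fun m => hF.lab_eq (mem_iInter.1 hy m)⟩
  choose p hp using h1
  have hinj : Function.Injective p := by
    intro x x' hxx
    exact Subtype.ext (hst.eq_of_lab_eq x.2 fun m => by rw [hp, hp, hxx])
  have hsurj : Function.Surjective p := by
    intro y
    have hfib : ∀ m, IsClosed {x | (st m).lab x = q m y} := fun m =>
      (st m).lab_locConst.isClosed_fiber _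
    obtain ⟨x, hx⟩ := IsCompact.nonempty_iInter_of_sequence_nonempty_isCompact_isClosed
      (fun m => {x | (st m).lab x = q m y})
      (fun m x hx => hF.lab_eq (hst.lab_anti (Nat.le_succ m) x (by
        rw [show (st (m + 1)).lab x = q (m + 1) y from hx]
        exact (hF.isBlockMap (m + 1)).mem_self y)))
      (fun m => (st m).exists_lab_eq y) (hfib 0).isCompact hfib
    have hxm : ∀ m, (st m).lab x = q m y := mem_iInter.1 hx
    refine ⟨⟨x, fun m => ?_⟩, hF.ext fun m => ?_⟩
    · rw [hxm]
      exact ⟨y, (hF.isBlockMap m).mem_self y⟩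
    · rw [← hp, ← hxm]
  have hcont : Continuous p := by
    rw [continuous_iff_continuousAt]
    intro x
    rw [ContinuousAt, (nhds_basis_clopen (p x)).tendsto_right_iff]
    rintro U ⟨hxU, hU⟩
    obtain ⟨m, hm⟩ := hF.separating U hU
    have hev := continuous_subtype_val.continuousAt.eventually ((st m).lab_locConst.eventually_eq
      (x : X))
    filter_upwards [hev] with x' hx'
    rw [hp, hp] at hx'
    exact hm _ hxU (hx' ▸ (hF.isBlockMap m).mem_self (p x'))
  have : CompactSpace (copy st) := isCompact_iff_compactSpace.1 isClosed_copy.isCompact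
  let e : copy st ≃ₜ Y :=
    hcont.homeoOfEquivCompactToT2 (f := Equiv.ofBijective p ⟨hinj, hsurj⟩)
  exact ⟨e.symm, fun y m => by rw [hp]; exact congrArg (q m) (e.apply_symm_apply y)⟩

theorem isEtale_copy : IsEtale Γ (copy st) := by
  intro γ hγ A hA
  obtain ⟨m, hm⟩ := hst.exists_coarse (Γ.inv_mem hγ)
  have hiff : ∀ x : copy st, γ.symm x ∈ copy st ↔ ((st m).lab (γ.symm x)).Nonempty := fun x =>
    ⟨fun h => h m, hst.mem_copy hF (hm x) x.2⟩
  let B : Set (copy st) := {x | γ.symm x ∈ copy st}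
  have hB : IsClopen B := by
    have h1 : IsLocallyConstant fun x : copy st => ((st m).lab (γ.symm x)).Nonempty :=
      ((st m).lab_locConst.comp Set.Nonempty).comp_continuous
        (γ.symm.continuous.comp continuous_subtype_val)
    have h2 := h1.isClopen_fiber True
    have h3 : B = {x : copy st | ((st m).lab (γ.symm x)).Nonempty = True} := by
      ext x
      simp [B, hiff]
    rw [h3]
    exact h2
  let φ : B → copy st := fun x => ⟨γ.symm x, x.2⟩
  have hφ : Continuous φ := (γ.symm.continuous.comp
    (continuous_subtype_val.comp continuous_subtype_val)).subtype_mk _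
  have himg : {y : copy st | ∃ a ∈ A, γ (a : X) = y} = Subtype.val '' (φ ⁻¹' A) := by
    ext y
    constructor
    · rintro ⟨a, ha, hay⟩
      have h1 : γ.symm y = a := by rw [← hay, γ.symm_apply_apply]
      refine ⟨⟨y, ?_⟩, ?_, rfl⟩
      · show γ.symm y ∈ copy st
        rw [h1]
        exact a.2
      · have h2 : φ ⟨y, by show γ.symm y ∈ copy st; rw [h1]; exact a.2⟩ = a := Subtype.ext h1
        rw [mem_preimage, h2]
        exact ha
    · rintro ⟨x, hx, rfl⟩
      exact ⟨φ x, hx, γ.apply_symm_apply _⟩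
  rw [himg]
  exact ⟨hB.isClosed.isClosedEmbedding_subtypeVal.isClosedMap _ (hA.isClosed.preimage hφ),
    hB.isOpen.isOpenEmbedding_subtypeVal.isOpenMap _ (hA.isOpen.preimage hφ)⟩

variable [CompactSpace X] [T2Space X] [TotallyDisconnectedSpace X]

/-- A point of `X` related to `h y` whose label is the translate by `s` of that of `h y` is
`h (s y)`. -/
theorem eq_apply {h : Y ≃ₜ copy st} (hh : ∀ y m, (st m).lab (h y) = q m y) {m : ℕ} {x : X} {y : Y}
    (hc : (st m).Coarse (H m) (h y) x) {s : Y ≃ₜ Y} (hs : s ∈ H m)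
    (hx : (st m).lab x = s '' (st m).lab (h y)) : x = h (s y) := by
  refine (hst.eq_of_lab_eq (h (s y)).2 fun n => ?_).symm
  rw [hh]
  refine (hF.lab_eq (hst.lab_anti (le_max_right m n) x ?_)).symm
  rw [hst.lab_image_of_le hF (le_max_left m n) hc hs hx, hh]
  exact mem_image_of_mem s ((hF.isBlockMap _).mem_self y)

/-- A homeomorphism that moves the points near `h y` inside coarse classes, and whose effect on the
label of `h y` is that of `s`, coincides with `s` near `h y`. -/
theorem eventually_eq_apply {h : Y ≃ₜ copy st} (hh : ∀ y m, (st m).lab (h y) = q m y) {m : ℕ}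
    {γ : X ≃ₜ X} {y : Y} (hc : ∀ᶠ x in 𝓝 (h y : X), (st m).Coarse (H m) x (γ x)) {s : Y ≃ₜ Y}
    (hs : s ∈ H m) (hy : (st m).lab (γ (h y)) = s '' (st m).lab (h y)) :
    ∀ᶠ y' in 𝓝 y, γ (h y') = h (s y') := by
  have hcont : Continuous fun y => (h y : X) := continuous_subtype_val.comp h.continuous
  have h1 := (st m).lab_locConst.eventually_eq (h y : X)
  have h2 := ((st m).lab_locConst.comp_continuous γ.continuous).eventually_eq (h y : X)
  filter_upwards [hcont.continuousAt.eventually (hc.and (h1.and h2))] with y' hy'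
  obtain ⟨h3, h4, h5⟩ := hy'
  exact hst.eq_apply hF hh h3 hs (h5.trans (by rw [h4]; exact hy))

variable [CompactSpace Y] [T2Space Y] [TotallyDisconnectedSpace Y]

theorem map_conjHomeo_eq_inducedGroup (hΓ : IsAmple Γ) (hS : IsAmple S) {h : Y ≃ₜ copy st}
    (hh : ∀ y m, (st m).lab (h y) = q m y) :
    S.map (conjHomeo h) = inducedGroup Γ (copy st) := by
  refine AmpleGroup.map_conjHomeo_eq_inducedGroup hΓ.full hS isClosed_copy
    (hst.isEtale_copy hF) h (fun γ hγ y hy => ?_) fun s hs y => ?_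
  · obtain ⟨m, hm⟩ := hst.exists_coarse hγ
    obtain ⟨s, hs, hxy⟩ := (hm (h y)).exists_image inf_le_left (hF.isBlockMap m) ((h y).2 m) (hy m)
    exact ⟨s, hF.le m hs, hst.eventually_eq_apply hF hh (Eventually.of_forall hm) hs hxy⟩
  · obtain ⟨m, hm⟩ := hF.exhaust s hs
    obtain ⟨w, hw, h1, h2⟩ := (st m).exists_lab_image (hF.isBlockMap m) ((h y).2 m) hm
    refine ⟨w, (st m).le hw, hst.eventually_eq_apply hF hh ?_ hm h1⟩
    filter_upwards [(st m).col_locConst.eventually_eq (h y : X),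
      ((st m).col_locConst.comp_continuous w.continuous).eventually_eq (h y : X)] with x hx hx'
    refine ⟨⟨w, hw, rfl⟩, ?_⟩
    rw [hx, show (st m).col (w x) = (st m).col (w (h y)) from hx', h2,
      (st m).col_of_lab _ ((h y).2 m), saturation_saturation inf_le_left,
      saturation_saturation inf_le_left, saturation_image hm]

theorem map_conjHomeo_eq_inducedGroup_limitGroup (hΓ : IsAmple Γ) (hΔ : IsAmple Δ) (hΔS : Δ ≤ S)
    {h : Y ≃ₜ copy st} (hh : ∀ y m, (st m).lab (h y) = q m y) :
    Δ.map (conjHomeo h) = inducedGroup hst.limitGroup (copy st) := by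
  refine AmpleGroup.map_conjHomeo_eq_inducedGroup (hst.isAmple_limitGroup hΓ).full hΔ
    isClosed_copy (fun γ hγ => hst.isEtale_copy hF γ hγ.1) h (fun γ hγ y hy => ?_)
    fun s hs y => ?_
  · obtain ⟨-, m, hm⟩ := hγ
    obtain ⟨s, hs, hxy⟩ := (hm (h y)).exists_image inf_le_left (hF.isBlockMap m) ((h y).2 m) (hy m)
    exact ⟨s, hs.2, hst.eventually_eq_apply hF hh
      (Eventually.of_forall fun x => (hm x).coarse (H m)) hs.1 hxy⟩
  · obtain ⟨m, hm⟩ := hF.exhaust s (hΔS hs)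
    obtain ⟨w, hw, h1, h2⟩ := (st m).exists_lab_image (hF.isBlockMap m) ((h y).2 m) hm
    have h3 : (st m).col (w (h y)) = (st m).col (h y) := by
      rw [h2, (st m).col_of_lab _ ((h y).2 m), saturation_image (Subgroup.mem_inf.2 ⟨hm, hs⟩)]
    obtain ⟨γ, hγ, hf, hev⟩ := (st m).exists_mem_eventuallyEq hΓ hw h3
    refine ⟨γ, ⟨hγ, m, hf⟩, hst.eventually_eq_apply hF hh
      (Eventually.of_forall fun x => (hf x).coarse (H m)) hm ?_⟩
    rw [hev.self_of_nhds, h1]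

omit [CompactSpace X] [T2Space X] [TotallyDisconnectedSpace X] [CompactSpace Y] [T2Space Y]
  [TotallyDisconnectedSpace Y] in
/-- If from stage `n` on each stage places labels in the preceding coarse class of `x`, then `x` is
finely related to a point of the copy: a labelled point in its fine class at stage `n` keeps
its label for ever. -/
theorem exists_fine_mem_copy {n : ℕ} {x : X}
    (h : ∀ m ≥ n, ∃ z, (st m).Coarse (H m) x z ∧ ((st (m + 1)).lab z).Nonempty) :
    ∃ z, (st n).Fine x z ∧ z ∈ copy st := by
  obtain ⟨z₀, hz₀, hz₀'⟩ := h n le_rfl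
  obtain ⟨z, hz, hz'⟩ := (st n).exists_fine_lab (hF.isBlockMap n) hz₀.symm
    (hz₀'.mono ((hst.step n).lab_subset z₀))
  have key : ∀ m ≥ n, ((st m).lab z).Nonempty := by
    intro m hm
    induction m, hm using Nat.le_induction with
    | base => exact hz'
    | succ m hm ih =>
      obtain ⟨u, hu, hu'⟩ := h m hm
      have huz : (st m).Coarse (H m) u z := hu.symm.trans (hst.coarse_mono hm (hz.coarse (H n)))
      obtain ⟨s, hs, hs'⟩ := huz.exists_image inf_le_left (hF.isBlockMap m)
        (hu'.mono ((hst.step m).lab_subset u)) ih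
      rw [(hst.step m).lab_image u z huz s hs hs']
      exact hu'.image s
  exact ⟨z, hz, fun m => (key _ (le_max_right m n)).mono (hst.lab_anti (le_max_left m n) z)⟩

/-- If `x` and `γ x` are finely related at no stage, then labels are placed in their coarse class at
all stages; both are then finely related to points of the copy, which `Γ_K` identifies. -/
theorem orbitRelation_eq (hΓ : IsAmple Γ) (hS : IsAmple S) :
    orbitRelation Γ = extendedRelation hst.limitGroup (copy st) (inducedGroup Γ (copy st)) := by
  obtain ⟨h, hh⟩ := hst.exists_homeomorph hF
  have hmap := hst.map_conjHomeo_eq_inducedGroup hF hΓ hS hh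
  apply le_antisymm
  · refine le_sInf ?_
    rintro T ⟨hT, hT'⟩
    have hfine : ∀ {m : ℕ} {x y : X}, (st m).Fine x y → T x y := by
      rintro m x _ ⟨⟨w, hw, rfl⟩, hc⟩
      obtain ⟨γ, hγ, hf, hev⟩ := (st m).exists_mem_eventuallyEq hΓ hw hc.symm
      exact hT ⟨γ, ⟨hγ, m, hf⟩, hev.self_of_nhds⟩
    rintro x _ ⟨γ, hγ, rfl⟩
    obtain ⟨n, hn⟩ := hst.exists_coarse hγ
    have hxy := hn x
    by_cases hex : ∃ m ≥ n, (st (m + 1)).Fine x (γ x)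
    · obtain ⟨m, -, hm⟩ := hex
      exact hfine hm
    · have hlab : ∀ m ≥ n, ∃ z, (st m).Coarse (H m) x z ∧ ((st (m + 1)).lab z).Nonempty := by
        intro m hm
        exact ((hst.step m).absorb x (γ x) (hst.coarse_mono hm hxy)).resolve_left
          fun h => hex ⟨m, hm, h⟩
      obtain ⟨z, hz, hzK⟩ := hst.exists_fine_mem_copy hF hlab
      obtain ⟨z', hz', hzK'⟩ := hst.exists_fine_mem_copy hF (n := n) (x := γ x) fun m hm => by
        obtain ⟨u, hu, hu'⟩ := hlab m hm
        exact ⟨u, (hst.coarse_mono hm hxy).symm.trans hu, hu'⟩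
      have hzz : (st n).Coarse (H n) z z' :=
        ((hz.coarse (H n)).symm.trans hxy).trans (hz'.coarse (H n))
      obtain ⟨s, hs, hs'⟩ := hzz.exists_image inf_le_left (hF.isBlockMap n) (hzK n) (hzK' n)
      obtain ⟨y, hy⟩ := h.surjective ⟨z, hzK⟩
      have hyz : (h y : X) = z := congrArg Subtype.val hy
      rw [← hyz] at hzz hs'
      have hsz : z' = h (s y) := hst.eq_apply hF hh hzz hs hs'
      have hδ : conjHomeo h s ∈ inducedGroup Γ (copy st) := by
        rw [← hmap]
        exact ⟨s, hF.le n hs, rfl⟩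
      have h1 := hT' _ hδ (h y)
      have h2 : conjHomeo h s (h y) = h (s y) :=
        congrArg (fun z => h (s z)) (h.symm_apply_apply y)
      rw [h2, hyz, ← hsz] at h1
      exact T.trans (hfine hz) (T.trans h1 (T.symm (hfine hz')))
  · refine sInf_le ⟨?_, ?_⟩
    · rintro x y ⟨γ, hγ, hxy⟩
      exact ⟨γ, hγ.1, hxy⟩
    · intro δ hδ x
      rw [← hmap] at hδ
      obtain ⟨s, hs, rfl⟩ := hδ
      obtain ⟨y, rfl⟩ := h.surjective x
      obtain ⟨m, hm⟩ := hF.exhaust s hs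
      obtain ⟨w, hw, h1, h2⟩ := (st m).exists_lab_image (hF.isBlockMap m) ((h y).2 m) hm
      refine ⟨w, (st m).le hw, ?_⟩
      have h3 : conjHomeo h s (h y) = h (s y) :=
        congrArg (fun z => h (s z)) (h.symm_apply_apply y)
      rw [h3]
      refine hst.eq_apply hF hh ⟨⟨w, hw, rfl⟩, ?_⟩ hm h1
      rw [h2, (st m).col_of_lab _ ((h y).2 m), saturation_saturation inf_le_left,
        saturation_saturation inf_le_left, saturation_image hm]

omit [CompactSpace X] [T2Space X] [TotallyDisconnectedSpace X] [T2Space Y]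
  [TotallyDisconnectedSpace Y] in
/-- At stage `m + 1` each set of equally labelled points has `m` times as many disjoint translates
as there are labels, so that the labelled set has measure at most `1 / m`. -/
theorem isThin_copy [MeasurableSpace X] [BorelSpace X] : IsThin hst.limitGroup (copy st) := by
  rintro μ ⟨hμ, hinv⟩
  have key : ∀ m : ℕ, (m : ENNReal) * μ (copy st) ≤ 1 := by
    intro m
    have hq := hF.isBlockMap (m + 1)
    have hfin : (range (q (m + 1))).Finite := hq.locConst.range_finite
    let c : ℕ := (range (q (m + 1))).ncard
    have hA : ∀ b, MeasurableSet {x | (st (m + 1)).lab x = b} := fun b =>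
      ((st (m + 1)).lab_locConst.isOpen_fiber b).measurableSet
    have hb : ∀ b ∈ range (q (m + 1)),
        ((m * c : ℕ) : ENNReal) * μ {x | (st (m + 1)).lab x = b} ≤ 1 := by
      rintro _ ⟨y, rfl⟩
      obtain ⟨γ, hγ, hd⟩ := (hst.step m).thin y
      have hpre : ∀ j, γ j '' {x | (st (m + 1)).lab x = q (m + 1) y} =
          (γ j).symm ⁻¹' {x | (st (m + 1)).lab x = q (m + 1) y} := fun j =>
        (γ j).image_eq_preimage_symm _
      have hmeas : ∀ j, μ (γ j '' {x | (st (m + 1)).lab x = q (m + 1) y}) =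
          μ {x | (st (m + 1)).lab x = q (m + 1) y} := by
        intro j
        have hj : (γ j)⁻¹ ∈ hst.limitGroup :=
          hst.limitGroup.inv_mem ⟨(hγ j).1, m + 1, (hγ j).2⟩
        have h1 := hinv _ hj
        rw [hpre]
        conv_rhs => rw [← h1]
        rw [Measure.map_apply ((γ j)⁻¹).continuous.measurable (hA _)]
        rfl
      have h2 : μ (⋃ j, γ j '' {x | (st (m + 1)).lab x = q (m + 1) y}) ≤ 1 := prob_le_one
      rw [measure_iUnion hd fun j => by
        rw [hpre]
        exact (γ j).symm.continuous.measurable (hA _), tsum_fintype] at h2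
      simp only [hmeas, Finset.sum_const, Finset.card_univ, Fintype.card_fin, nsmul_eq_mul] at h2
      exact h2
    have hcov : copy st ⊆ ⋃ b ∈ hfin.toFinset, {x | (st (m + 1)).lab x = b} := by
      intro x hx
      obtain ⟨y, hy⟩ := (st (m + 1)).lab_cases x (hx (m + 1))
      exact mem_iUnion₂.2 ⟨q (m + 1) y, by simp, hy⟩
    have hcard : hfin.toFinset.card = c := (ncard_eq_toFinset_card _ hfin).symm
    rcases Nat.eq_zero_or_pos c with hc | hc
    · have h3 : hfin.toFinset = ∅ := Finset.card_eq_zero.1 (hcard.trans hc)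
      have h4 : copy st = ∅ := by
        rw [h3] at hcov
        exact subset_empty_iff.1 (by simpa using hcov)
      rw [h4]
      simp
    · have h3 : (c : ENNReal) * (m * μ (copy st)) ≤ c * 1 := by
        calc (c : ENNReal) * (m * μ (copy st)) = ((m * c : ℕ) : ENNReal) * μ (copy st) := by
              push_cast
              ring
          _ ≤ ((m * c : ℕ) : ENNReal) *
              ∑ b ∈ hfin.toFinset, μ {x | (st (m + 1)).lab x = b} :=
              mul_le_mul_right ((measure_mono hcov).trans (measure_biUnion_finset_le _ _)) _
          _ = ∑ b ∈ hfin.toFinset, ((m * c : ℕ) : ENNReal) * μ {x | (st (m + 1)).lab x = b} :=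
              Finset.mul_sum _ _ _
          _ ≤ ∑ _b ∈ hfin.toFinset, 1 :=
              Finset.sum_le_sum fun b hbm => hb b (hfin.mem_toFinset.1 hbm)
          _ = c * 1 := by simp [hcard]
      exact (ENNReal.mul_le_mul_iff_right (by exact_mod_cast hc.ne') (ENNReal.natCast_ne_top c)).1
        h3
  by_contra hne
  obtain ⟨n, hn⟩ := ENNReal.exists_nat_mul_gt hne ENNReal.one_ne_top
  exact absurd (key n) (not_le.2 hn)

end IsStageSequence

end Limit

/-! ### Existence of the sequence and the theorem -/

/-- The first stage has the trivial group, one label and one colour. -/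
theorem exists_isStageSequence {X Y : Type*} [TopologicalSpace X] [TopologicalSpace Y]
    [CompactSpace X] [T2Space X] [TotallyDisconnectedSpace X] [SecondCountableTopology X]
    [Nonempty X] [∀ x : X, NeBot (𝓝[≠] x)] [CompactSpace Y] [Nonempty Y]
    {Γ : Subgroup (X ≃ₜ X)} (hΓ : IsAmple Γ) (hmin : IsMinimal Γ) {S Δ : Subgroup (Y ≃ₜ Y)}
    {H : ℕ → Subgroup (Y ≃ₜ Y)} {q : ℕ → Y → Set Y} (hF : IsFiltration S H q) :
    ∃ (st : ∀ m, Stage Γ (H m ⊓ Δ) (q m)) (σ : ℕ → (X ≃ₜ X)) (C : ℕ → Set X),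
      IsStageSequence H st σ C := by
  classical
  have : Countable (TopologicalSpace.Clopens X) :=
    TopologicalSpace.Clopens.countable_iff_secondCountable.2 inferInstance
  have : Countable {U : TopologicalSpace.Clopens X // (U : Set X).Nonempty} := inferInstance
  have : Nonempty {U : TopologicalSpace.Clopens X // (U : Set X).Nonempty} :=
    ⟨⟨⊤, by simp⟩⟩
  obtain ⟨C, hC⟩ := exists_surjective_nat
    {U : TopologicalSpace.Clopens X // (U : Set X).Nonempty}
  have : Countable Γ := hΓ.countable.to_subtype
  obtain ⟨σ, hσ⟩ := exists_surjective_nat Γ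
  have hstep : ∀ m (s : Stage Γ (H m ⊓ Δ) (q m)), ∃ s' : Stage Γ (H (m + 1) ⊓ Δ) (q (m + 1)),
      IsStep s s' (H m) (H (m + 1)) (σ m) (C m).1 m := fun m s =>
    s.exists_isStep hΓ hmin (hF.isBlockMap m) (hF.isBlockMap (m + 1)) (hF.mono (Nat.le_succ m))
      (hF.refine_succ m) inf_le_left (inf_le_inf_right Δ (hF.mono (Nat.le_succ m))) inf_le_left
      (σ m).2 (C m).1.isClopen (C m).2 m
  choose next hnext using hstep
  have hsat : saturation (H 0 ⊓ Δ) (univ : Set Y) = univ :=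
    univ_subset_iff.1 (subset_saturation _ _)
  obtain ⟨x₀⟩ := ‹Nonempty X›
  let st₀ : Stage Γ (H 0 ⊓ Δ) (q 0) :=
    { W := ⊥
      finite := by simp
      le := bot_le
      col := fun _ => univ
      lab := fun _ => univ
      col_locConst := IsLocallyConstant.const _
      lab_locConst := IsLocallyConstant.const _
      lab_cases := fun x h => ⟨h.some, (hF.block_zero _).symm⟩
      col_cases := fun x h => ⟨h.some, by rw [hF.block_zero, hsat]⟩
      col_of_lab := fun _ _ => hsat.symm
      inj := by
        intro w hw x _ _
        rw [Subgroup.mem_bot.1 hw]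
        rfl
      surj := fun x _ y => ⟨1, Subgroup.one_mem _, (hF.block_zero y).symm⟩
      exists_col := ⟨x₀, univ_nonempty⟩ }
  let st : ∀ m, Stage Γ (H m ⊓ Δ) (q m) := fun m => Nat.rec st₀ next m
  refine ⟨st, fun m => σ m, fun m => (C m).1, fun m => hnext m (st m), fun γ hγ => ?_,
    fun U hU hne => ?_⟩
  · obtain ⟨m, hm⟩ := hσ ⟨γ, hγ⟩
    exact ⟨m, congrArg Subtype.val hm⟩
  · obtain ⟨m, hm⟩ := hC ⟨⟨U, hU⟩, hne⟩
    exact ⟨m, congrArg (fun V => (V.1 : Set X)) hm⟩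

/-- The Cantor space has no isolated points: `a` is the limit of points that differ from it in one
coordinate only. -/
theorem neBot_nhdsNE_cantor (a : ℕ → Bool) : NeBot (𝓝[≠] a) := by
  rw [← mem_closure_iff_nhdsWithin_neBot]
  have ht : Tendsto (fun n => Function.update a n (!a n)) atTop (𝓝 a) := by
    rw [tendsto_pi_nhds]
    intro i
    refine tendsto_const_nhds.congr' ?_
    filter_upwards [eventually_gt_atTop i] with n hn
    rw [Function.update_of_ne hn.ne]
  refine mem_closure_of_tendsto ht (Eventually.of_forall fun n h => ?_)
  have h1 := congrFun (show Function.update a n (!a n) = a from h) n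
  simp at h1

end AmpleGroup

open AmpleGroup in
theorem mainTheorem3
    {X : Type*} [TopologicalSpace X] [MeasurableSpace X] [BorelSpace X]
    (hX : Nonempty (X ≃ₜ (ℕ → Bool)))
    {Y : Type*} [MetricSpace Y] [CompactSpace Y]
    (hY : TopologicalSpace.IsTopologicalBasis {U : Set Y | IsClopen U})
    (Δ S : Subgroup (Y ≃ₜ Y)) (hΔ : AmpleGroup.IsAmple Δ) (hS : AmpleGroup.IsAmple S)
    (hΔS : Δ ≤ S)
    (Γ : Subgroup (X ≃ₜ X)) (hΓ : AmpleGroup.IsAmple Γ) (hΓmin : AmpleGroup.IsMinimal Γ) :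
    ∃ (Λ : Subgroup (X ≃ₜ X)) (K : Set X) (h : Y ≃ₜ K),
      AmpleGroup.IsAmple Λ ∧ AmpleGroup.IsMinimal Λ ∧ Λ ≤ Γ ∧
      AmpleGroup.IsMalleable Λ K ∧ AmpleGroup.IsMalleable Γ K ∧
      Δ.map (AmpleGroup.conjHomeo h) = AmpleGroup.inducedGroup Λ K ∧
      S.map (AmpleGroup.conjHomeo h) = AmpleGroup.inducedGroup Γ K ∧
      AmpleGroup.orbitRelation Γ =
        AmpleGroup.extendedRelation Λ K (AmpleGroup.inducedGroup Γ K) := by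
  obtain ⟨e⟩ := hX
  have : CompactSpace X := e.symm.compactSpace
  have : T2Space X := e.symm.t2Space
  have : TotallyDisconnectedSpace X := e.isEmbedding.isTotallyDisconnected_range.1 <|
    isTotallyDisconnected_of_totallyDisconnectedSpace _
  have : SecondCountableTopology X := e.secondCountableTopology
  have : Nonempty X := ⟨e.symm fun _ => false⟩
  have : ∀ x : X, Filter.NeBot (nhdsWithin x {x}ᶜ) := by
    intro x
    have := neBot_nhdsNE_cantor (e x)
    have h1 := e.isEmbedding.map_nhdsWithin_eq {x}ᶜ x
    rw [Set.image_compl_eq e.bijective, Set.image_singleton] at h1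
    rw [← h1] at this
    exact Filter.map_neBot_iff _ |>.1 this
  have : TotallySeparatedSpace Y := totallySeparatedSpace_of_t0_of_basis_clopen hY
  rcases isEmpty_or_nonempty Y with hE | hE
  -- For empty `Y` the groups `Λ = Γ` and the empty set will do.
  · let h : Y ≃ₜ (∅ : Set X) := ⟨Equiv.equivOfIsEmpty _ _, continuous_of_const fun y => hE.elim y,
      continuous_of_const fun y => y.2.elim⟩
    have hs : ∀ A B : Subgroup ((∅ : Set X) ≃ₜ (∅ : Set X)), A = B := fun A B =>
      Subgroup.ext fun g => by
        have : g = 1 := Homeomorph.ext fun x => x.2.elim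
        rw [this]
        exact iff_of_true A.one_mem B.one_mem
    have hm : IsMalleable Γ (∅ : Set X) := ⟨isClosed_empty, fun μ _ => MeasureTheory.measure_empty,
      fun γ _ A _ => by
        rw [Set.eq_empty_of_isEmpty {y : (∅ : Set X) | ∃ a ∈ A, γ (a : X) = y}]
        exact isClopen_empty⟩
    refine ⟨Γ, ∅, h, hΓ, hΓmin, le_rfl, hm, hm, hs _ _, hs _ _, le_antisymm ?_ ?_⟩
    · exact le_sInf fun T hT => hT.1
    · exact sInf_le ⟨le_rfl, fun _ _ x => x.2.elim⟩
  · obtain ⟨H, q, hF⟩ := hS.exists_isFiltration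
    obtain ⟨st, σ, C, hst⟩ := exists_isStageSequence (Δ := Δ) hΓ hΓmin hF
    obtain ⟨h, hh⟩ := hst.exists_homeomorph hF
    have hthin := hst.isThin_copy hF
    refine ⟨hst.limitGroup, copy st, h, hst.isAmple_limitGroup hΓ, hst.isMinimal_limitGroup hΓ,
      hst.limitGroup_le, ⟨isClosed_copy, hthin, fun γ hγ => hst.isEtale_copy hF γ hγ.1⟩,
      ⟨isClosed_copy, fun μ hμ => hthin μ ⟨hμ.1, fun γ hγ => hμ.2 γ hγ.1⟩,
        hst.isEtale_copy hF⟩,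
      hst.map_conjHomeo_eq_inducedGroup_limitGroup hF hΓ hΔ hΔS hh,
      hst.map_conjHomeo_eq_inducedGroup hF hΓ hS hh, hst.orbitRelation_eq hF hΓ hS⟩
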